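/- **Theorem 3.1.** Let $\Sigma$ be a finite set, let $P$ and $P_n=\{p_n(x,y)\}$ ($n\ge 1$) be stochastic matrices on $\Sigma$ with $P_n\to P$ entrywise, let $\pi$ be a probability distribution on $\Sigma$, and let $\mathbb P_\pi$ be the law on $\Sigma^{\infty}$ of the nonhomogeneous Markov chain $X_0,X_1,\dots$ with initial distribution $\pi$ and with transition matrix $P_n$ from time $n-1$ to time $n$. Let $f:\Sigma\to\mathbb R^d$ and $Z_n=\frac1n\sum_{i=1}^n f(X_i)$. Conventions: $\log 0=-\infty$ and $0\cdot(\pm\infty)=0$. *Blocks.* Let $C_1,\dots,C_{N+M}$ be the communicating classes of $P$ ($x,y$ are in the same class iff each can be reached from the other in zero or more steps of positive $P$-probability). Let $\mathcal G=\{\zeta_1,\dots,\zeta_M\}$ be the set of indices $i$ for which the submatrix $P_{C_i}$ is irreducible (any two states of $C_i$ are joined by a path in $C_i$ of length at least $1$ and positive weight); for the $N$ other indices $P_{C_i}$ is the $1\times1$ zero matrix. *Resting costs.* For $i\in\mathcal G$ and $\lambda\in\mathbb R^d$ let $\rho_i(\lambda)$ be the Perron–Frobenius eigenvalue of the matrix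 $\{p(x,y)e^{\langle\lambda,f(y)\rangle}:x,y\in C_i\}$, and let $\mathbb I_i(x)=\sup_{\lambda\in\mathbb R^d}\{\langle\lambda,x\rangle-\log\rho_i(\lambda)\}$. *Upper routing cost.* For distinct $i,j\in\{1,\dots,N+M\}$ let $t(n,(i,j))=\max_{x\in C_i,\,y\in C_j}p_n(x,y)$, let $\upsilon(i,j)=\limsup_{n\to\infty}\frac1n\log t(n,(i,j))$, and let $$\mathcal U_0(i,j)=\max_{0\le k\le N+M-2}\ \max_{\langle l_0,\dots,l_{k+1}\rangle}\ \sum_{s=0}^{k}\upsilon(l_s,l_{s+1}),$$ where the inner maximum is over tuples of distinct indices in $\{1,\dots,N+M\}$ with $l_0=i$ and $l_{k+1}=j$. *Rate function.* For $z\in\mathbb R^d$ let $$\mathbb J_{\mathcal U_0}(z)=\inf_{v}\ \inf_{x}\ \min_{\sigma}\left[-\sum_{i=1}^{M-1}\Big(\sum_{j=1}^i v_j\Big)\,\mathcal U_0(\zeta_{\sigma(i)},\zeta_{\sigma(i+1)})+\sum_{i=1}^M v_i\,\mathbb I_{\zeta_{\sigma(i)}}(x_i)\right],$$ over probability vectors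 $v=(v_1,\dots,v_M)$, points $x=(x_1,\dots,x_M)\in(\mathbb R^d)^M$ with $\sum_{i=1}^M v_ix_i=z$, and permutations $\sigma$ of $\{1,\dots,M\}$. (If $M=1$, this is $\mathbb I_{\zeta_1}(z)$.) Then $\mathbb J_{\mathcal U_0}$ is a good rate function, i.e. it takes values in $[0,\infty]$, is lower semicontinuous, and $\{z:\mathbb J_{\mathcal U_0}(z)\le a\}$ is compact for every $a\in\mathbb R$; and for every Borel set $\Gamma\subset\mathbb R^d$, $$\limsup_{n\to\infty}\frac1n\log\mathbb P_\pi(Z_n\in\overline\Gamma)\ \le\ -\inf_{z\in\overline\Gamma}\mathbb J_{\mathcal U_0}(z).$$ -/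

import Mathlib

open MeasureTheory ProbabilityTheory Filter Topology
open scoped ENNReal

noncomputable section

namespace PerturbedChain

/-! ### The nonhomogeneous Markov measure -/

section Chain

variable {S : Type*} [Fintype S] [DecidableEq S] [MeasurableSpace S] [MeasurableSingletonClass S]

/-- The row `i` of a row-stochastic matrix, as a probability mass function. -/
def rowPMF (Q : Matrix S S ℝ) (hQ : Q ∈ Matrix.rowStochastic ℝ S) (i : S) : PMF S :=
  PMF.ofFintype (fun j => ENNReal.ofReal (Q i j)) (by
    rw [← ENNReal.ofReal_sum_of_nonneg (fun j _ => hQ.1 i j),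
      Matrix.sum_row_of_mem_rowStochastic hQ i, ENNReal.ofReal_one])

/-- The one-step Markov kernel of a row-stochastic matrix. -/
def rowKernel (Q : Matrix S S ℝ) (hQ : Q ∈ Matrix.rowStochastic ℝ S) : Kernel S S where
  toFun i := (rowPMF Q hQ i).toMeasure
  measurable' := measurable_of_finite _

instance (Q : Matrix S S ℝ) (hQ : Q ∈ Matrix.rowStochastic ℝ S) :
    IsMarkovKernel (rowKernel Q hQ) :=
  ⟨fun i => inferInstanceAs (IsProbabilityMeasure (rowPMF Q hQ i).toMeasure)⟩

/-- Given the history up to time `n`, the next state is drawn from the row of `Q (n + 1)` indexed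
by the present state. -/
def stepKernel (Q : ℕ → Matrix S S ℝ) (hQ : ∀ n, 1 ≤ n → Q n ∈ Matrix.rowStochastic ℝ S) (n : ℕ) :
    Kernel (∀ _ : Finset.Iic n, S) S :=
  (rowKernel (Q (n + 1)) (hQ (n + 1) (Nat.le_add_left 1 n))).comap
    (fun h => h ⟨n, Finset.mem_Iic.2 le_rfl⟩) (measurable_pi_apply _)

instance (Q : ℕ → Matrix S S ℝ) (hQ : ∀ n, 1 ≤ n → Q n ∈ Matrix.rowStochastic ℝ S) (n : ℕ) :
    IsMarkovKernel (stepKernel Q hQ n) :=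
  inferInstanceAs (IsMarkovKernel (Kernel.comap _ _ _))

/-- The law, on the sequence space, of the nonhomogeneous Markov chain `X₀, X₁, …` with initial
distribution `π` and transition matrix `Q n` from time `n - 1` to time `n`, for `n ≥ 1`. -/
def markovMeasure (π : PMF S) (Q : ℕ → Matrix S S ℝ)
    (hQ : ∀ n, 1 ≤ n → Q n ∈ Matrix.rowStochastic ℝ S) : Measure (ℕ → S) :=
  Kernel.trajMeasure (X := fun _ => S) π.toMeasure (stepKernel Q hQ)

instance (π : PMF S) (Q : ℕ → Matrix S S ℝ)
    (hQ : ∀ n, 1 ≤ n → Q n ∈ Matrix.rowStochastic ℝ S) :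
    IsProbabilityMeasure (markovMeasure π Q hQ) :=
  inferInstanceAs (IsProbabilityMeasure (Kernel.trajMeasure (X := fun _ => S) _ _))

/-- The finite-dimensional distributions of the chain. -/
theorem markovMeasure_cylinder (π : PMF S) (Q : ℕ → Matrix S S ℝ)
    (hQ : ∀ n, 1 ≤ n → Q n ∈ Matrix.rowStochastic ℝ S) (n : ℕ) (x : ℕ → S) :
    markovMeasure π Q hQ {ω | ∀ i ≤ n, ω i = x i} =
      π (x 0) * ∏ i ∈ Finset.range n, ENNReal.ofReal (Q (i + 1) (x i) (x (i + 1))) := by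
  have hset : ∀ m : ℕ, {ω : ℕ → S | ∀ i ≤ m, ω i = x i} =
      Preorder.frestrictLe (π := fun _ => S) m ⁻¹' {Preorder.frestrictLe (π := fun _ => S) m x} := by
    intro m
    ext ω
    simp only [Set.mem_ofPred_eq, Set.mem_preimage, Set.mem_singleton_iff, funext_iff,
      Preorder.frestrictLe_apply, Subtype.forall, Finset.mem_Iic]
  induction n with
  | zero =>
    have h0 : (markovMeasure π Q hQ).map (fun ω => ω 0) = π.toMeasure := by
      have h1 : (markovMeasure π Q hQ).map (Preorder.frestrictLe (π := fun _ => S) 0) =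
          π.toMeasure.map
            (MeasurableEquiv.piUnique (fun _ : Finset.Iic (0 : ℕ) => S)).symm := by
        rw [markovMeasure, Kernel.trajMeasure, Measure.map_comp _ _ (by fun_prop),
          Kernel.traj_map_frestrictLe, Kernel.partialTraj_self, Measure.id_comp]
      have h2 := congrArg (Measure.map (fun h : (∀ _ : Finset.Iic (0 : ℕ), S) => h default)) h1
      rw [Measure.map_map (by fun_prop) (by fun_prop),
        Measure.map_map (by fun_prop) (by fun_prop)] at h2
      have h3 : (fun h : (∀ _ : Finset.Iic (0 : ℕ), S) => h default) ∘
          (MeasurableEquiv.piUnique (fun _ : Finset.Iic (0 : ℕ) => S)).symm = id := by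
        ext s
        exact (MeasurableEquiv.piUnique (fun _ : Finset.Iic (0 : ℕ) => S)).apply_symm_apply s
      rw [h3, Measure.map_id] at h2
      exact h2
    have h4 : {ω : ℕ → S | ∀ i ≤ 0, ω i = x i} = (fun ω : ℕ → S => ω 0) ⁻¹' {x 0} := by
      ext ω
      simp
    rw [h4, ← Measure.map_apply (by fun_prop) (measurableSet_singleton _), h0,
      PMF.toMeasure_apply_singleton _ _ (measurableSet_singleton _)]
    simp
  | succ n ih =>
    have h5 : {ω : ℕ → S | ∀ i ≤ n + 1, ω i = x i} =
        (fun ω : ℕ → S => (Preorder.frestrictLe (π := fun _ => S) n ω, ω (n + 1))) ⁻¹'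
          ({Preorder.frestrictLe (π := fun _ => S) n x} ×ˢ {x (n + 1)}) := by
      have h6 := hset n
      ext ω
      have h7 := Set.ext_iff.1 h6 ω
      simp only [Set.mem_ofPred_eq, Set.mem_preimage, Set.mem_singleton_iff] at h7
      simp only [Set.mem_ofPred_eq, Set.mem_preimage, Set.mem_prod, Set.mem_singleton_iff, ← h7]
      constructor
      · exact fun h => ⟨fun i hi => h i (by omega), h _ le_rfl⟩
      · rintro ⟨h, h'⟩ i hi
        rcases Nat.le_succ_iff.1 hi with hi | rfl
        · exact h i hi
        · exact h'
    have hm : MeasurableSet {Preorder.frestrictLe (π := fun _ => S) n x} :=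
      measurableSet_singleton _
    have h8 := Kernel.map_frestrictLe_trajMeasure_compProd_eq_map_trajMeasure
      (X := fun _ => S) (μ₀ := π.toMeasure) (κ := stepKernel Q hQ) (a := n)
    rw [h5, ← Measure.map_apply (by fun_prop) (hm.prod (measurableSet_singleton _)),
      markovMeasure, ← h8, Measure.compProd_apply_prod hm (measurableSet_singleton _),
      lintegral_singleton, Measure.map_apply (by fun_prop) hm, ← hset n]
    rw [markovMeasure] at ih
    rw [ih, Finset.prod_range_succ]
    have h9 : stepKernel Q hQ n (Preorder.frestrictLe (π := fun _ => S) n x) {x (n + 1)} =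
        ENNReal.ofReal (Q (n + 1) (x n) (x (n + 1))) := by
      change (rowPMF (Q (n + 1)) _ (x n)).toMeasure {x (n + 1)} = _
      rw [PMF.toMeasure_apply_singleton _ _ (measurableSet_singleton _)]
      rfl
    rw [h9, mul_comm, mul_assoc]

end Chain

/-- The empirical averages `Z_n = (1/n) ∑_{i=1}^n f(X_i)`. -/
def Z {S : Type*} {d : ℕ} (f : S → EuclideanSpace ℝ (Fin d)) (n : ℕ) (ω : ℕ → S) :
    EuclideanSpace ℝ (Fin d) :=
  (1 / (n : ℝ)) • ∑ i ∈ Finset.Icc 1 n, f (ω i)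

/-- Good rate functions: nonnegative, lower semicontinuous, with compact level sets. -/
structure IsGoodRateFunction {E : Type*} [TopologicalSpace E] (I : E → EReal) : Prop where
  nonneg : ∀ x, 0 ≤ I x
  lowerSemicontinuous : LowerSemicontinuous I
  isCompact_level : ∀ a : ℝ, IsCompact {x | I x ≤ (a : EReal)}

/-! ### The canonical decomposition of a stochastic matrix

The diagonal blocks of the canonical (upper block triangular) form are carried by the communicating
classes: `x` and `y` lie in the same block iff each of them can be reached from the other in zero or
more steps of positive weight. -/

section Decomposition

variable {S : Type*}

/-- `x` and `y` communicate under `P`. -/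
def commSetoid (P : Matrix S S ℝ) : Setoid S where
  r x y := Relation.ReflTransGen (fun a b => 0 < P a b) x y ∧
    Relation.ReflTransGen (fun a b => 0 < P a b) y x
  iseqv := ⟨fun _ => ⟨.refl, .refl⟩, fun h => ⟨h.2, h.1⟩,
    fun h h' => ⟨h.1.trans h'.1, h'.2.trans h.2⟩⟩

/-- The index set of the blocks of the canonical decomposition (`N + M` elements). -/
def Block (P : Matrix S S ℝ) : Type _ := Quotient (commSetoid P)

/-- The set of states `C_i` of the block `i`. -/
def Block.states {P : Matrix S S ℝ} (i : Block P) : Set S :=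
  {x | Quotient.mk (commSetoid P) x = i}

/-- The submatrix `P_C`. -/
def block (P : Matrix S S ℝ) (C : Set S) : Matrix C C ℝ :=
  P.submatrix Subtype.val Subtype.val

/-- The nondegenerate blocks `𝒢`: those whose submatrix is irreducible, the other ones being the
`1 × 1` zero matrices of the degenerate transient states. (Irreducibility asks for paths of positive
length.) -/
def Nondeg (P : Matrix S S ℝ) : Type _ :=
  {i : Block P // (block P i.states).IsIrreducible}

/-- `M`, the number of nondegenerate blocks. -/
def numNondeg (P : Matrix S S ℝ) : ℕ := Nat.card (Nondeg P)

end Decomposition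

/-! ### Resting costs -/

section Rest

variable {S : Type*} [Fintype S] {d : ℕ}

/-- The tilted matrix `{u(x,y) e^{⟨λ, f(y)⟩} : x, y ∈ C}`. -/
def tilted (U : Matrix S S ℝ) (f : S → EuclideanSpace ℝ (Fin d)) (C : Set S)
    (lam : EuclideanSpace ℝ (Fin d)) : Matrix C C ℝ :=
  Matrix.of fun x y => U x y * Real.exp (inner ℝ lam (f y))

open Classical in
/-- The Perron–Frobenius eigenvalue of a nonnegative matrix: the largest modulus of its complex
eigenvalues. -/
def perronRoot {C : Type*} [Fintype C] (A : Matrix C C ℝ) : ℝ≥0∞ :=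
  spectralRadius ℂ (A.map Complex.ofReal)

open Classical in
/-- The resting cost `𝕀_{C,f,U}(x) = sup_λ {⟨λ, x⟩ - log ρ(C, λ)}`. -/
def restCost (U : Matrix S S ℝ) (f : S → EuclideanSpace ℝ (Fin d)) (C : Set S)
    (x : EuclideanSpace ℝ (Fin d)) : EReal :=
  ⨆ lam : EuclideanSpace ℝ (Fin d),
    ((inner ℝ lam x : ℝ) : EReal) - ENNReal.log (perronRoot (tilted U f C lam))

end Rest

/-! ### Routing costs and the rate function -/

section Routing

variable {S : Type*}

/-- `t(n, (i, j))`, the largest entry of `Q n` from the block `i` to the block `j`. -/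
def connProb {P : Matrix S S ℝ} (Q : ℕ → Matrix S S ℝ) (n : ℕ) (i j : Block P) : ℝ≥0∞ :=
  ⨆ x ∈ i.states, ⨆ y ∈ j.states, ENNReal.ofReal (Q n x y)

/-- `υ(i, j) = limsup (1/n) log t(n, (i, j))`, with `log 0 = -∞`. -/
def upperConnRate {P : Matrix S S ℝ} (Q : ℕ → Matrix S S ℝ) (i j : Block P) : EReal :=
  limsup (fun n : ℕ => ((1 / (n : ℝ) : ℝ) : EReal) * ENNReal.log (connProb Q n i j)) atTop

/-- The upper routing cost `𝒰₀(i, j)` (for distinct `i`, `j`): the maximum, over all tuples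
`L = ⟨i = l_0, l_1, …, l_{k+1} = j⟩` of distinct blocks, of `∑_s υ(l_s, l_{s+1})`. Distinctness
bounds `k + 2` by the number of blocks. -/
def upperCost (P : Matrix S S ℝ) (Q : ℕ → Matrix S S ℝ) (i j : Block P) : EReal :=
  ⨆ (k : ℕ) (L : Fin (k + 2) → Block P)
    (_ : Function.Injective L ∧ L 0 = i ∧ L (Fin.last (k + 1)) = j),
    ∑ s : Fin (k + 1), upperConnRate Q (L s.castSucc) (L s.succ)

variable [Fintype S] {d : ℕ}

/-- The cost `C_{v,U}(σ, x)`. Here `σ i` is the `i`-th nondegenerate block in the order of visits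
(`ζ_{σ(i)}` for an enumeration `ζ` of the nondegenerate blocks). When `M = 1` the first sum is zero,
so that the cost is the resting cost of the only block. The conventions of `EReal` are
`0 * ⊤ = 0 * ⊥ = 0`. -/
def pathCost (P : Matrix S S ℝ) (f : S → EuclideanSpace ℝ (Fin d)) (U : Block P → Block P → EReal)
    (v : Fin (numNondeg P) → ℝ) (σ : Fin (numNondeg P) ≃ Nondeg P)
    (x : Fin (numNondeg P) → EuclideanSpace ℝ (Fin d)) : EReal :=
  (∑ i : Fin (numNondeg P),
      if h : (i : ℕ) + 1 < numNondeg P then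
        -(((∑ j ∈ Finset.Iic i, v j : ℝ) : EReal) * U (σ i).1 (σ ⟨i + 1, h⟩).1)
      else 0) +
    ∑ i : Fin (numNondeg P), (v i : EReal) * restCost P f (σ i).1.states (x i)

/-- The function `𝕁_U(z)`: the infimum of the costs over probability vectors `v`, points `x` with
`∑ v_i x_i = z`, and orders of visit `σ`. -/
def J (P : Matrix S S ℝ) (f : S → EuclideanSpace ℝ (Fin d)) (U : Block P → Block P → EReal)
    (z : EuclideanSpace ℝ (Fin d)) : EReal :=
  ⨅ (v : Fin (numNondeg P) → ℝ) (_ : v ∈ stdSimplex ℝ (Fin (numNondeg P)))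
    (x : Fin (numNondeg P) → EuclideanSpace ℝ (Fin d)) (_ : ∑ i, v i • x i = z)
    (σ : Fin (numNondeg P) ≃ Nondeg P), pathCost P f U v σ x

end Routing

end PerturbedChain

end

/-! The bound is an exponential Chebyshev inequality with one tilt per block. A path is summarised
by its block statistics: the fraction of time `v_b` spent in each block and the averaged sum `y_b`
of `f` over those times. An order `σ` of the nondegenerate blocks, tilts `λ_b`, growth rates `r_b >
ρ_b(λ_b)` and switching rates `w_i ≤ 0`, each zero or above the routing rate, give the linear score
`∑_b (⟨λ_b, y_b⟩ - v_b log r_b) - ∑_i (∑_{j≤i} v_{σ(j)}) w_i`.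

Resting. Since `r_b > ρ_b(λ_b)`, Neumann series in the blocks, weighted according to reachability,
form a function that is strictly superharmonic for `P` with the tilted weights
(`exists_strict_superharmonic`). By strictness and finiteness it is superharmonic for `Q n`, `n`
large, so the total tilted weight of all paths stays bounded, even after boundedly many transition
factors are erased (`sum_paths_erased_le`).

Switching. Order the nondegenerate blocks by their last visits. After the last visit to `σ(i)`, at a
time `L`, the path still has to reach `σ(i+1)`. Loop erasure (`exists_simple_path`) extracts from
this passage the steps of a simple path of blocks, at times after `L`; connection rates are
nonpositive, so the product of their probabilities is at most a constant times `exp(L w_i)`. All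
visits to `σ(1), …, σ(i)` occur by time `L`, so `L` is at least their number, which yields the
cumulative sums in the cost. A bounded number of times is marked in this way (`exists_marks`). There
are polynomially many sets of marks, so the paths of order `σ` with score at least `a` have weight
at most a polynomial times `exp(-na)` (`exists_sum_paths_score_le`).

Duality. The cost of a statistic is the supremum of its scores (`exists_tilt_of_lt_J`,
`score_le_pathCost`); a degenerate block occupied for a positive fraction of time has Perron root
zero and allows arbitrarily large scores. Statistics range over a compact set, so finitely many
parameters suffice for a closed set. Compactness also makes the level sets of the rate function
compact (`isGoodRateFunction_J`). -/

namespace PerturbedChain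

/-! ### Perron roots: row sums and Neumann series. -/

section PerronRoot

variable {C : Type*} [Fintype C]

attribute [local instance] Matrix.linftyOpNormedRing Matrix.linftyOpNormedAlgebra

theorem perronRoot_zero : perronRoot (0 : Matrix C C ℝ) = 0 := by
  classical
  have h : (0 : Matrix C C ℝ).map Complex.ofReal = 0 := by ext; simp
  rw [perronRoot, h, spectrum.spectralRadius_zero]

/-- The Perron root of a nonnegative matrix is at most its largest row sum. -/
theorem perronRoot_le (A : Matrix C C ℝ) (hA : ∀ i j, 0 ≤ A i j) {c : ℝ}
    (hc : ∀ i, ∑ j, A i j ≤ c) : perronRoot A ≤ ENNReal.ofReal c := by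
  classical
  -- Bounding the spectral radius by the norm uses `‖1‖ = 1`, which fails on an empty index type.
  rcases isEmpty_or_nonempty C with hC | hC
  · have h : A = 0 := by ext i; exact hC.elim i
    rw [h, perronRoot_zero]
    exact zero_le
  unfold perronRoot
  have : NormOneClass (Matrix C C ℂ) := Matrix.linfty_opNormOneClass
  refine le_trans (by convert spectrum.spectralRadius_le_nnnorm (𝕜 := ℂ) (A.map Complex.ofReal)) ?_
  rw [Matrix.linfty_opNNNorm_def, ENNReal.ofReal, ENNReal.coe_le_coe]
  refine Finset.sup_le fun i _ => ?_
  rw [← NNReal.coe_le_coe, Real.coe_toNNReal _ ((Finset.sum_nonneg fun j _ => hA i j).trans (hc i))]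
  push_cast
  refine le_of_eq_of_le (Finset.sum_congr rfl fun j _ => ?_) (hc i)
  simp [abs_of_nonneg (hA i j)]

open Classical in
/-- The powers of a matrix whose Perron root is below `r` are summable against `r⁻ᵏ`. -/
theorem summable_pow_of_perronRoot_lt (A : Matrix C C ℝ) {r : ℝ} (hr : 0 < r)
    (h : perronRoot A < ENNReal.ofReal r) (i j : C) :
    Summable fun k : ℕ => (r ^ k)⁻¹ * (A ^ k) i j := by
  set B : Matrix C C ℂ := A.map Complex.ofReal with hB
  have h' : spectralRadius ℂ B < ENNReal.ofReal r := by
    exact h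
  -- Gelfand's formula bounds `‖B ^ k‖` by `q ^ k` eventually, so the series is dominated by a
  -- geometric one of ratio `q / r < 1`.
  obtain ⟨q, hq1, hq2⟩ := ENNReal.lt_iff_exists_nnreal_btwn.1 h'
  have hqr : (q : ℝ) < r := by
    rw [← ENNReal.ofReal_coe_nnreal, ENNReal.ofReal_lt_ofReal_iff hr] at hq2
    exact hq2
  have hev : ∀ᶠ k : ℕ in atTop, ‖B ^ k‖ ≤ (q : ℝ) ^ k := by
    filter_upwards [(spectrum.pow_norm_pow_one_div_tendsto_nhds_spectralRadius B).eventually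
      (gt_mem_nhds hq1), eventually_ge_atTop 1] with k hk hk1
    have hk2 : ‖B ^ k‖ ^ (1 / (k : ℝ)) ≤ q := by
      rw [← ENNReal.ofReal_coe_nnreal] at hk
      by_contra! hlt
      exact absurd hk (not_lt.2 (ENNReal.ofReal_le_ofReal hlt.le))
    have hk3 := pow_le_pow_left₀ (by positivity) hk2 k
    rwa [← Real.rpow_natCast, ← Real.rpow_mul (norm_nonneg _), one_div,
      inv_mul_cancel₀ (by positivity), Real.rpow_one] at hk3
  have hent : ∀ k : ℕ, |(A ^ k) i j| ≤ ‖B ^ k‖ := by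
    intro k
    have h1 : B ^ k = (A ^ k).map Complex.ofReal := by
      have := (Matrix.map_pow A Complex.ofRealHom k)
      exact this.symm
    rw [h1, Matrix.linfty_opNorm_def]
    have h2 : ‖((A ^ k).map Complex.ofReal) i j‖₊ ≤
        Finset.univ.sup fun i => ∑ j, ‖((A ^ k).map Complex.ofReal) i j‖₊ :=
      le_trans (Finset.single_le_sum (f := fun j => ‖((A ^ k).map Complex.ofReal) i j‖₊)
        (fun _ _ => zero_le) (Finset.mem_univ j))
        (Finset.le_sup (f := fun i => ∑ j, ‖((A ^ k).map Complex.ofReal) i j‖₊)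
          (Finset.mem_univ i))
    have h3 : (‖((A ^ k).map Complex.ofReal) i j‖₊ : ℝ) = |(A ^ k) i j| := by simp
    rw [← h3]
    exact_mod_cast h2
  refine Summable.of_norm_bounded_eventually_nat (g := fun k => ((q : ℝ) / r) ^ k)
    (summable_geometric_of_lt_one (by positivity) ((div_lt_one hr).2 hqr)) ?_
  filter_upwards [hev] with k hk
  rw [norm_mul, Real.norm_eq_abs, Real.norm_eq_abs, abs_of_pos (by positivity), div_pow,
    inv_mul_eq_div]
  gcongr
  exact (hent k).trans hk

/-- The Neumann series of a nonnegative matrix, applied to the constant vector `1`. -/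
theorem exists_superharmonic_of_perronRoot_lt (A : Matrix C C ℝ) (hA : ∀ i j, 0 ≤ A i j) {r : ℝ}
    (hr : 0 < r) (h : perronRoot A < ENNReal.ofReal r) :
    ∃ v : C → ℝ, (∀ i, 1 ≤ v i) ∧ ∀ i, ∑ j, A i j * v j = r * (v i - 1) := by
  classical
  have hs : ∀ i, Summable fun k : ℕ => ∑ j, (r ^ k)⁻¹ * (A ^ k) i j := fun i =>
    summable_sum fun j _ => summable_pow_of_perronRoot_lt A hr h i j
  have hv : ∀ i, (∑' k : ℕ, ∑ j, (r ^ k)⁻¹ * (A ^ k) i j) =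
      1 + ∑' k : ℕ, ∑ j, (r ^ (k + 1))⁻¹ * (A ^ (k + 1)) i j := by
    intro i
    rw [(hs i).tsum_eq_zero_add]
    simp [Matrix.one_apply]
  refine ⟨fun i => ∑' k : ℕ, ∑ j, (r ^ k)⁻¹ * (A ^ k) i j, fun i => ?_, fun i => ?_⟩
  · beta_reduce
    rw [hv i, le_add_iff_nonneg_right]
    exact tsum_nonneg fun k => Finset.sum_nonneg fun j _ =>
      mul_nonneg (by positivity) (Matrix.pow_apply_nonneg hA _ _ _)
  · beta_reduce
    -- Applying `A` shifts the Neumann series by one index, so only its zeroth term `1` is lost.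
    rw [hv i, add_sub_cancel_left]
    simp_rw [← tsum_mul_left]
    rw [← Summable.tsum_finsetSum fun j _ => (hs j).mul_left _]
    refine tsum_congr fun k => ?_
    simp_rw [pow_succ' A k, Matrix.mul_apply, Finset.mul_sum]
    rw [Finset.sum_comm]
    refine Finset.sum_congr rfl fun j _ => Finset.sum_congr rfl fun l _ => ?_
    rw [pow_succ, mul_inv]
    field_simp

end PerronRoot

/-! ### Perron roots of tilted matrices. -/

section Tilted

variable {S : Type*} {d : ℕ}

theorem tilted_nonneg {U : Matrix S S ℝ} (hU : ∀ i j, 0 ≤ U i j)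
    (f : S → EuclideanSpace ℝ (Fin d)) (C : Set S) (lam : EuclideanSpace ℝ (Fin d)) (i j : C) :
    0 ≤ tilted U f C lam i j :=
  mul_nonneg (hU _ _) (Real.exp_pos _).le

open Classical in
/-- The Perron root of the tilted matrix of a set of states. -/
noncomputable def tiltedRoot [Fintype S] (U : Matrix S S ℝ) (f : S → EuclideanSpace ℝ (Fin d))
    (C : Set S) (lam : EuclideanSpace ℝ (Fin d)) : ℝ≥0∞ :=
  perronRoot (tilted U f C lam)

theorem restCost_eq [Fintype S] (U : Matrix S S ℝ) (f : S → EuclideanSpace ℝ (Fin d)) (C : Set S)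
    (x : EuclideanSpace ℝ (Fin d)) :
    restCost U f C x = ⨆ lam : EuclideanSpace ℝ (Fin d),
      ((inner ℝ lam x : ℝ) : EReal) - ENNReal.log (tiltedRoot U f C lam) :=
  rfl

/-- Row sums of a submatrix of a stochastic matrix are at most `1`, and each tilting factor is at
most `exp (‖lam‖ * F)`. -/
theorem tiltedRoot_le [Fintype S] {U : Matrix S S ℝ} (hU : ∀ i j, 0 ≤ U i j) (hU1 : ∀ i, ∑ j, U i j = 1)
    (f : S → EuclideanSpace ℝ (Fin d)) (C : Set S) (lam : EuclideanSpace ℝ (Fin d)) {F : ℝ}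
    (hF : ∀ s, ‖f s‖ ≤ F) :
    tiltedRoot U f C lam ≤ ENNReal.ofReal (Real.exp (‖lam‖ * F)) := by
  classical
  unfold tiltedRoot
  refine perronRoot_le _ (tilted_nonneg hU f C lam) fun i => ?_
  calc ∑ j : C, tilted U f C lam i j ≤ ∑ j : C, U i j * Real.exp (‖lam‖ * F) := by
        refine Finset.sum_le_sum fun j _ => mul_le_mul_of_nonneg_left ?_ (hU _ _)
        refine Real.exp_le_exp.2 ((real_inner_le_norm _ _).trans ?_)
        exact mul_le_mul_of_nonneg_left (hF _) (norm_nonneg _)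
    _ = (∑ j : C, U i j) * Real.exp (‖lam‖ * F) := by rw [Finset.sum_mul]
    _ ≤ 1 * Real.exp (‖lam‖ * F) := by
        refine mul_le_mul_of_nonneg_right ?_ (Real.exp_pos _).le
        rw [← hU1 i]
        exact (Finset.sum_subtype C.toFinset (fun _ => Set.mem_toFinset) (U i)).symm.trans_le
          (Finset.sum_le_univ_sum_of_nonneg fun j => hU i j)
    _ = _ := one_mul _

end Tilted

/-! ### Communicating classes and reachability. -/

section Blocks

variable {S : Type*} {P : Matrix S S ℝ}

/-- The block of a state. -/
def blockOf (P : Matrix S S ℝ) (x : S) : Block P := Quotient.mk (commSetoid P) x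

instance [Finite S] (P : Matrix S S ℝ) : Finite (Block P) :=
  inferInstanceAs (Finite (Quotient (commSetoid P)))

noncomputable instance [Fintype S] (P : Matrix S S ℝ) : Fintype (Block P) := Fintype.ofFinite _

noncomputable instance (P : Matrix S S ℝ) : DecidableEq (Block P) := Classical.decEq _

instance [Finite S] (P : Matrix S S ℝ) : Finite (Nondeg P) :=
  inferInstanceAs (Finite {i : Block P // (block P i.states).IsIrreducible})

theorem mem_states_iff {i : Block P} {x : S} : x ∈ i.states ↔ blockOf P x = i := Iff.rfl

theorem blockOf_eq_iff {x y : S} : blockOf P x = blockOf P y ↔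
    Relation.ReflTransGen (fun a b => 0 < P a b) x y ∧
      Relation.ReflTransGen (fun a b => 0 < P a b) y x :=
  Quotient.eq (r := commSetoid P)

/-- Inside a block, paths of positive weight can be taken within the block. -/
theorem nonempty_path_block {C : Block P} {x y : S} (hx : x ∈ C.states) (hy : y ∈ C.states)
    (h : Relation.ReflTransGen (fun a b => 0 < P a b) x y) :
    Nonempty (@Quiver.Path _ (block P C.states).toQuiver ⟨x, hx⟩ ⟨y, hy⟩) := by
  let _ := (block P C.states).toQuiver
  induction h using Relation.ReflTransGen.head_induction_on with
  | refl => exact ⟨Quiver.Path.nil⟩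
  | @head a c hac hcy ih =>
    have hc : c ∈ C.states := by
      rw [mem_states_iff] at hx hy ⊢
      -- `c` lies on a path from `a` to `y`, and `y` leads back to `a`; hence `c` communicates with
      -- `y`.
      have h1 := blockOf_eq_iff.1 (hy.trans hx.symm)
      rw [← hy]
      exact blockOf_eq_iff.2 ⟨hcy, h1.1.trans (.single hac)⟩
    obtain ⟨p⟩ := ih hc
    exact ⟨(Quiver.Hom.toPath (show (⟨a, hx⟩ : C.states) ⟶ ⟨c, hc⟩ from ⟨hac⟩)).comp p⟩

/-- The submatrix of a degenerate block vanishes. -/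
theorem block_eq_zero (hP : ∀ i j, 0 ≤ P i j) {C : Block P}
    (hC : ¬ (block P C.states).IsIrreducible) {x y : S} (hx : x ∈ C.states) (hy : y ∈ C.states) :
    P x y = 0 := by
  by_contra hne
  have hxy : 0 < P x y := lt_of_le_of_ne (hP x y) (Ne.symm hne)
  refine hC ⟨fun i j => hP _ _, ?_⟩
  let _ := (block P C.states).toQuiver
  rintro ⟨a, ha⟩ ⟨b, hb⟩
  obtain ⟨p⟩ := nonempty_path_block ha hx
    (blockOf_eq_iff.1 ((mem_states_iff.1 ha).trans (mem_states_iff.1 hx).symm)).1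
  obtain ⟨q⟩ := nonempty_path_block hy hb
    (blockOf_eq_iff.1 ((mem_states_iff.1 hy).trans (mem_states_iff.1 hb).symm)).1
  -- One positive entry suffices: any two states are joined through the edge from `x` to `y`, hence
  -- by a path of positive length.
  refine ⟨p.comp ((Quiver.Hom.toPath (show (⟨x, hx⟩ : C.states) ⟶ ⟨y, hy⟩ from ⟨hxy⟩)).comp q), ?_⟩
  simp only [Quiver.Path.length_comp, Quiver.Path.length_toPath]
  omega

theorem tiltedRoot_eq_zero [Fintype S] {d : ℕ} (hP : ∀ i j, 0 ≤ P i j)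
    (f : S → EuclideanSpace ℝ (Fin d)) (lam : EuclideanSpace ℝ (Fin d)) {C : Block P}
    (hC : ¬ (block P C.states).IsIrreducible) : tiltedRoot P f C.states lam = 0 := by
  classical
  have h : tilted P f C.states lam = 0 := by
    ext x y
    simp [tilted, block_eq_zero hP hC x.2 y.2]
  rw [tiltedRoot, h]
  exact perronRoot_zero

/-- The number of states which can be reached from `x`. -/
noncomputable def reachCard (P : Matrix S S ℝ) (x : S) : ℕ :=
  Set.ncard {z | Relation.ReflTransGen (fun a b => 0 < P a b) x z}

/-- `reachCard` grades the blocks: it is constant on each block and drops strictly along every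
transition between blocks, since the source can no longer be reached. -/
theorem reachCard_lt [Finite S] {x y : S} (h : 0 < P x y) (hne : blockOf P x ≠ blockOf P y) :
    reachCard P y < reachCard P x := by
  refine Set.ncard_lt_ncard ⟨fun z hz => Relation.ReflTransGen.head h hz, fun hsub => hne ?_⟩
    (Set.toFinite _)
  exact blockOf_eq_iff.2 ⟨.single h, hsub Relation.ReflTransGen.refl⟩

theorem reachCard_eq {x y : S} (h : blockOf P x = blockOf P y) :
    reachCard P x = reachCard P y := by
  obtain ⟨h1, h2⟩ := blockOf_eq_iff.1 h
  unfold reachCard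
  congr 1
  ext z
  exact ⟨fun hz => h2.trans hz, fun hz => h1.trans hz⟩

end Blocks

/-! ### Gluing the block vectors into a superharmonic function. -/

section Superharmonic

variable {S : Type*} [Fintype S] {d : ℕ} {P : Matrix S S ℝ}

/-- The weight of a visit to the state `y`, for a tilt depending on the block. -/
noncomputable def gain (f : S → EuclideanSpace ℝ (Fin d))
    (lam : Block P → EuclideanSpace ℝ (Fin d)) (r : Block P → ℝ) (y : S) : ℝ :=
  Real.exp (inner ℝ (lam (blockOf P y)) (f y)) / r (blockOf P y)

variable {f : S → EuclideanSpace ℝ (Fin d)} {lam : Block P → EuclideanSpace ℝ (Fin d)}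
  {r : Block P → ℝ}

omit [Fintype S] in
theorem gain_pos (hr : ∀ b, 0 < r b) (y : S) : 0 < gain f lam r y :=
  div_pos (Real.exp_pos _) (hr _)

/-- A function which is strictly superharmonic for the matrix weighted by `gain`. -/
theorem exists_strict_superharmonic (hP : ∀ i j, 0 ≤ P i j) (hr : ∀ b, 0 < r b)
    (hρ : ∀ b : Block P, tiltedRoot P f b.states (lam b) < ENNReal.ofReal (r b)) :
    ∃ h : S → ℝ, (∀ x, 1 ≤ h x) ∧ ∀ x, ∑ y, P x y * (gain f lam r y * h y) < h x := by
  classical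
  have hex : ∀ b : Block P, ∃ v : b.states → ℝ, (∀ i, 1 ≤ v i) ∧
      ∀ i, ∑ j, tilted P f b.states (lam b) i j * v j = r b * (v i - 1) := by
    intro b
    have h1 := hρ b
    unfold tiltedRoot at h1
    have h2 := exists_superharmonic_of_perronRoot_lt (tilted P f b.states (lam b))
      (tilted_nonneg hP f b.states (lam b)) (hr b) h1
    exact h2
  choose v hv1 hv2 using hex
  set h₀ : S → ℝ := fun x => v (blockOf P x) ⟨x, rfl⟩ with hh₀
  have h₀1 : ∀ x, 1 ≤ h₀ x := fun x => hv1 _ _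
  have hg : ∀ y, 0 < gain f lam r y := gain_pos hr
  have hin : ∀ x, ∑ y with blockOf P y = blockOf P x, P x y * (gain f lam r y * h₀ y) =
      h₀ x - 1 := by
    intro x
    have h1 := hv2 (blockOf P x) ⟨x, rfl⟩
    have h2 : ∑ y with blockOf P y = blockOf P x, P x y * (gain f lam r y * h₀ y) =
        ∑ y : (blockOf P x).states, P x y * (gain f lam r y * h₀ y) :=
      Finset.sum_subtype _ (fun y => by simp [mem_states_iff]) _
    have h3 : ∀ b (y : S) (hb : blockOf P y = b), h₀ y = v b ⟨y, hb⟩ := by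
      intro b y hb
      subst hb
      rfl
    rw [h2, ← mul_right_inj' (hr (blockOf P x)).ne', ← h1, Finset.mul_sum]
    refine Finset.sum_congr rfl fun y _ => ?_
    obtain ⟨y, hy⟩ := y
    rw [mem_states_iff] at hy
    rw [h3 _ y hy]
    simp only [tilted, Matrix.of_apply, gain, hy]
    have := (hr (blockOf P x)).ne'
    field_simp
  -- Weighting by `c ^ reachCard` discounts every change of block by at least `c⁻¹`. With this `c`
  -- all changes of block together contribute at most half of `c ^ reachCard P x * (1 - c⁻¹)`, less
  -- than the slack `c ^ reachCard P x` left inside the block.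
  set c : ℝ := 1 + 2 * ∑ y, (∑ x, P x y) * (gain f lam r y * h₀ y) with hc
  have hc1 : 1 ≤ c := by
    rw [hc, le_add_iff_nonneg_right]
    exact mul_nonneg zero_le_two (Finset.sum_nonneg fun y _ => mul_nonneg
      (Finset.sum_nonneg fun x _ => hP x y) (mul_nonneg (hg y).le (zero_le_one.trans (h₀1 y))))
  refine ⟨fun x => c ^ reachCard P x * h₀ x,
    fun x => one_le_mul_of_one_le_of_one_le (one_le_pow₀ hc1) (h₀1 x), fun x => ?_⟩
  have hpos : 0 < c ^ reachCard P x := by positivity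
  rw [← Finset.sum_filter_add_sum_filter_not Finset.univ (fun y => blockOf P y = blockOf P x)]
  have e1 : ∑ y with blockOf P y = blockOf P x,
      P x y * (gain f lam r y * (c ^ reachCard P y * h₀ y)) =
      c ^ reachCard P x * (h₀ x - 1) := by
    rw [← hin x, Finset.mul_sum]
    refine Finset.sum_congr rfl fun y hy => ?_
    rw [reachCard_eq (Finset.mem_filter.1 hy).2]
    ring
  have e2 : 2 * ∑ y with ¬ blockOf P y = blockOf P x,
      P x y * (gain f lam r y * (c ^ reachCard P y * h₀ y)) ≤ c ^ reachCard P x * (1 - c⁻¹) := by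
    have hterm : ∀ y, ¬ blockOf P y = blockOf P x →
        P x y * (gain f lam r y * (c ^ reachCard P y * h₀ y)) ≤
          c ^ reachCard P x * c⁻¹ * ((∑ x, P x y) * (gain f lam r y * h₀ y)) := by
      intro y hy
      have hgh : 0 ≤ gain f lam r y * h₀ y := mul_nonneg (hg y).le (zero_le_one.trans (h₀1 y))
      have hsum : P x y ≤ ∑ x, P x y := Finset.single_le_sum (f := fun x => P x y)
        (fun x _ => hP x y) (Finset.mem_univ x)
      rcases (hP x y).eq_or_lt with h0 | h0
      · rw [← h0, zero_mul]
        exact mul_nonneg (by positivity) (mul_nonneg ((hP x y).trans hsum) hgh)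
      · have hlt := reachCard_lt h0 (Ne.symm hy)
        have hpow : c ^ reachCard P y ≤ c ^ reachCard P x * c⁻¹ := by
          rw [← div_eq_mul_inv, le_div_iff₀ (by positivity), ← pow_succ]
          exact pow_le_pow_right₀ hc1 hlt
        calc P x y * (gain f lam r y * (c ^ reachCard P y * h₀ y))
            = c ^ reachCard P y * (P x y * (gain f lam r y * h₀ y)) := by ring
          _ ≤ _ := mul_le_mul hpow (mul_le_mul_of_nonneg_right hsum hgh)
              (mul_nonneg h0.le hgh) (by positivity)
    have hle := Finset.sum_le_sum (s := Finset.univ.filter fun y => ¬ blockOf P y = blockOf P x)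
      fun y hy => hterm y (Finset.mem_filter.1 hy).2
    rw [← Finset.mul_sum] at hle
    have hle2 : ∑ y with ¬ blockOf P y = blockOf P x, (∑ x, P x y) * (gain f lam r y * h₀ y) ≤
        ∑ y, (∑ x, P x y) * (gain f lam r y * h₀ y) :=
      Finset.sum_le_univ_sum_of_nonneg fun y => mul_nonneg
      (Finset.sum_nonneg fun x _ => hP x y) (mul_nonneg (hg y).le (zero_le_one.trans (h₀1 y)))
    calc _ ≤ 2 * (c ^ reachCard P x * c⁻¹ * ∑ y, (∑ x, P x y) * (gain f lam r y * h₀ y)) := by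
          gcongr
          exact hle.trans (by gcongr)
      _ = c ^ reachCard P x * c⁻¹ * (c - 1) := by rw [hc]; ring
      _ = _ := by field_simp
  have hcinv : 0 < c⁻¹ := by positivity
  rw [e1]
  nlinarith
end Superharmonic

/-! ### Total weights of finite paths. -/

section PathSums

variable {S : Type*} [Fintype S]

/-- The extension of a finite path by its last state. -/
def extPath {n : ℕ} (x : Fin (n + 1) → S) (k : ℕ) : S := x ⟨min k n, by omega⟩

omit [Fintype S] in
theorem extPath_coe {n : ℕ} (x : Fin (n + 1) → S) (k : Fin (n + 1)) : extPath x k = x k := by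
  exact congrArg x (Fin.ext (min_eq_left (Nat.lt_succ_iff.1 k.2)))

/-- The total weight of the paths of length `n`, when the weights admit a superharmonic
function. -/
theorem sum_paths_mul_le (W : ℕ → S → S → ℝ) (hW : ∀ k x y, 0 ≤ W k x y) (h : S → ℝ)
    (κ : ℕ → ℝ) (hκ : ∀ k x, ∑ y, W k x y * h y ≤ κ k * h x) (hκ0 : ∀ k, 0 ≤ κ k) (n : ℕ) :
    ∑ x : Fin (n + 1) → S, (∏ k : Fin n, W k (x k.castSucc) (x k.succ)) * h (x (Fin.last n)) ≤
      (∏ k ∈ Finset.range n, κ k) * ∑ s, h s := by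
  induction n with
  | zero =>
    simp only [Finset.univ_eq_empty, Finset.prod_empty, one_mul, Finset.range_zero]
    refine le_of_eq (Fintype.sum_equiv (Equiv.funUnique (Fin 1) S) _ _ fun x => ?_)
    rfl
  | succ n ih =>
    rw [← (Fin.snocEquiv fun _ : Fin (n + 2) => S).sum_comp, Fintype.sum_prod_type_right]
    have h1 : ∀ x : Fin (n + 1) → S, ∑ s : S,
        (∏ k : Fin (n + 1), W k (Fin.snoc (α := fun _ => S) x s k.castSucc)
          (Fin.snoc (α := fun _ => S) x s k.succ)) *
            h (Fin.snoc (α := fun _ => S) x s (Fin.last (n + 1))) ≤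
        κ n * ((∏ k : Fin n, W k (x k.castSucc) (x k.succ)) * h (x (Fin.last n))) := by
      intro x
      have h2 : ∀ s : S, (∏ k : Fin (n + 1), W k (Fin.snoc (α := fun _ => S) x s k.castSucc)
          (Fin.snoc (α := fun _ => S) x s k.succ)) *
            h (Fin.snoc (α := fun _ => S) x s (Fin.last (n + 1))) =
          (∏ k : Fin n, W k (x k.castSucc) (x k.succ)) * (W n (x (Fin.last n)) s * h s) := by
        intro s
        rw [Fin.prod_univ_castSucc, mul_assoc]
        congr 1
        · refine Finset.prod_congr rfl fun k _ => ?_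
          rw [Fin.snoc_castSucc, Fin.succ_castSucc, Fin.snoc_castSucc, Fin.val_castSucc]
        · rw [Fin.succ_last, Fin.snoc_last, Fin.snoc_castSucc, Fin.val_last]
      simp_rw [h2]
      rw [← Finset.mul_sum, mul_left_comm]
      exact mul_le_mul_of_nonneg_left (hκ n _) (Finset.prod_nonneg fun k _ => hW _ _ _)
    refine (Finset.sum_le_sum fun x _ => h1 x).trans ?_
    rw [← Finset.mul_sum, Finset.prod_range_succ, mul_comm _ (κ n), mul_assoc]
    exact mul_le_mul_of_nonneg_left ih (hκ0 n)

theorem sum_paths_le (W : ℕ → S → S → ℝ) (hW : ∀ k x y, 0 ≤ W k x y) (h : S → ℝ)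
    (h1 : ∀ x, 1 ≤ h x) (κ : ℕ → ℝ) (hκ : ∀ k x, ∑ y, W k x y * h y ≤ κ k * h x)
    (hκ0 : ∀ k, 0 ≤ κ k) (n : ℕ) :
    ∑ x : Fin (n + 1) → S, ∏ k ∈ Finset.range n, W k (extPath x k) (extPath x (k + 1)) ≤
      (∏ k ∈ Finset.range n, κ k) * ∑ s, h s := by
  refine le_trans (Finset.sum_le_sum fun x _ => ?_) (sum_paths_mul_le W hW h κ hκ hκ0 n)
  rw [Finset.prod_range]
  have h2 : ∏ k : Fin n, W k (extPath x k) (extPath x (k + 1)) =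
      ∏ k : Fin n, W k (x k.castSucc) (x k.succ) := by
    refine Finset.prod_congr rfl fun k _ => ?_
    rw [← extPath_coe x k.castSucc, ← extPath_coe x k.succ]
    rfl
  rw [h2]
  exact le_mul_of_one_le_right (Finset.prod_nonneg fun k _ => hW _ _ _) (h1 _)

/-- An unmarked late step costs a factor at most `1` by superharmonicity. A marked step, or one of
the first `n₀` steps, costs at most `K`, because `h ≥ 1` and the entries of `Q` are at most `1`. The
constants depend on neither the marks nor the length. -/
theorem sum_paths_erased_le {Q : ℕ → Matrix S S ℝ} (hQ0 : ∀ n, 1 ≤ n → ∀ i j, 0 ≤ Q n i j)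
    (hQ1 : ∀ n, 1 ≤ n → ∀ i j, Q n i j ≤ 1) (g : S → ℝ) (hg : ∀ y, 0 < g y) (h : S → ℝ)
    (h1 : ∀ x, 1 ≤ h x)
    (hh : ∀ᶠ n in atTop, ∀ x, ∑ y, Q n x y * (g y * h y) ≤ h x) :
    ∃ C K : ℝ, 1 ≤ C ∧ 1 ≤ K ∧ ∀ (A : Finset ℕ) (n : ℕ), ∑ x : Fin (n + 1) → S,
      ∏ k ∈ Finset.range n, (if k + 1 ∈ A then 1 else Q (k + 1) (extPath x k) (extPath x (k + 1))) *
        g (extPath x (k + 1)) ≤ C * K ^ A.card := by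
  obtain ⟨n₀, hn₀⟩ := eventually_atTop.1 hh
  set K : ℝ := 1 + ∑ y, g y * h y with hK
  have hgh : ∀ y, 0 ≤ g y * h y := fun y => mul_nonneg (hg y).le (zero_le_one.trans (h1 y))
  have hsum0 : 0 ≤ ∑ y, g y * h y := Finset.sum_nonneg fun y _ => hgh y
  have hK1 : 1 ≤ K := by rw [hK]; linarith
  have hKh : ∀ x, ∑ y, g y * h y ≤ K * h x := fun x => by
    nlinarith [h1 x]
  refine ⟨K ^ n₀ * (1 + ∑ s, h s), K, ?_, hK1, fun A n => ?_⟩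
  · refine one_le_mul_of_one_le_of_one_le (one_le_pow₀ hK1) ?_
    rw [le_add_iff_nonneg_right]
    exact Finset.sum_nonneg fun y _ => zero_le_one.trans (h1 y)
  · set κ : ℕ → ℝ := fun k => (if k + 1 ∈ A then K else 1) * (if k < n₀ then K else 1) with hκ
    have hκ1 : ∀ k, 1 ≤ κ k := fun k =>
      one_le_mul_of_one_le_of_one_le (by split_ifs <;> simp [hK1]) (by split_ifs <;> simp [hK1])
    have hmain := sum_paths_le (fun k x y => (if k + 1 ∈ A then 1 else Q (k + 1) x y) * g y)
      (fun k x y => mul_nonneg (by split_ifs; exacts [zero_le_one, hQ0 _ (by omega) _ _]) (hg y).le)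
      h h1 κ (fun k x => ?_) (fun k => zero_le_one.trans (hκ1 k)) n
    · refine hmain.trans ?_
      have e1 : ∏ k ∈ Finset.range n, κ k ≤ K ^ A.card * K ^ n₀ := by
        rw [hκ, Finset.prod_mul_distrib, Finset.prod_ite, Finset.prod_ite]
        simp only [Finset.prod_const, one_pow, mul_one]
        refine mul_le_mul (pow_le_pow_right₀ hK1 ?_) (pow_le_pow_right₀ hK1 ?_) (by positivity)
          (by positivity)
        · refine Finset.card_le_card_of_injOn (fun k => k + 1) (fun k hk => ?_) (fun a _ b _ h => ?_)
          · simpa using (Finset.mem_filter.1 hk).2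
          · simpa using h
        · refine (Finset.card_le_card (t := Finset.range n₀) fun k hk => ?_).trans
            (Finset.card_range _).le
          simpa using (Finset.mem_filter.1 hk).2
      have hs : 0 ≤ ∑ s, h s := Finset.sum_nonneg fun y _ => zero_le_one.trans (h1 y)
      calc (∏ k ∈ Finset.range n, κ k) * ∑ s, h s ≤ (K ^ A.card * K ^ n₀) * (1 + ∑ s, h s) :=
            mul_le_mul e1 (by linarith) hs (by positivity)
        _ = _ := by ring
    · simp only [mul_assoc]
      by_cases hA : k + 1 ∈ A
      · simp only [hA, if_true, one_mul, hκ]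
        refine (hKh x).trans (mul_le_mul_of_nonneg_right ?_ (zero_le_one.trans (h1 x)))
        have h2 : (1 : ℝ) ≤ if k < n₀ then K else 1 := by split_ifs <;> simp [hK1]
        simpa only [mul_assoc] using
          (mul_le_mul_of_nonneg_left h2 (zero_le_one.trans hK1)).trans' (mul_one K).ge
      · simp only [hA, if_false, one_mul, hκ]
        by_cases hk : k < n₀
        · simp only [hk, if_true]
          refine le_trans (Finset.sum_le_sum fun y _ => ?_) (hKh x)
          exact mul_le_of_le_one_left (hgh y) (hQ1 _ (by omega) _ _)
        · simp only [hk, if_false, one_mul]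
          exact hn₀ (k + 1) (by omega) x

end PathSums

/-! ### From probabilities to path weights. -/

section Chain

variable {S : Type*} [Fintype S] [DecidableEq S] [MeasurableSpace S] [MeasurableSingletonClass S]

open Classical in
/-- The probability of an event depending on the times up to `n` is at most the sum of the
weights of the corresponding paths. -/
theorem markovMeasure_le_sum_paths (π : PMF S) (Q : ℕ → Matrix S S ℝ)
    (hQ : ∀ n, 1 ≤ n → Q n ∈ Matrix.rowStochastic ℝ S) (n : ℕ) (E : Set (ℕ → S))
    (hE : ∀ ω ω' : ℕ → S, (∀ i ≤ n, ω i = ω' i) → ω ∈ E → ω' ∈ E) :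
    markovMeasure π Q hQ E ≤ ENNReal.ofReal (∑ x : Fin (n + 1) → S with extPath x ∈ E,
      ∏ k ∈ Finset.range n, Q (k + 1) (extPath x k) (extPath x (k + 1))) := by
  have hnn : ∀ (x : Fin (n + 1) → S), ∀ k ∈ Finset.range n,
      0 ≤ Q (k + 1) (extPath x k) (extPath x (k + 1)) :=
    fun x k _ => (hQ (k + 1) (by omega)).1 _ _
  rw [ENNReal.ofReal_sum_of_nonneg fun x _ => Finset.prod_nonneg (hnn x)]
  have hsub : E ⊆ ⋃ x ∈ Finset.univ.filter fun x : Fin (n + 1) → S => extPath x ∈ E,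
      {ω | ∀ i ≤ n, ω i = extPath x i} := by
    intro ω hω
    have h1 : ∀ i ≤ n, ω i = extPath (fun k : Fin (n + 1) => ω k) i := by
      intro i hi
      simp [extPath, hi]
    simp only [Set.mem_iUnion]
    exact ⟨fun k => ω k, Finset.mem_filter.2 ⟨Finset.mem_univ _, hE _ _ h1 hω⟩, h1⟩
  refine (measure_mono hsub).trans ((measure_biUnion_finset_le _ _).trans ?_)
  refine Finset.sum_le_sum fun x _ => ?_
  rw [markovMeasure_cylinder, ENNReal.ofReal_prod_of_nonneg (hnn x)]
  exact mul_le_of_le_one_left zero_le (PMF.coe_le_one _ _)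

end Chain

/-! ### Distributing strict inequalities over extended real sums. -/

section ERealSums

/-- Replaces extended costs by real parameters. Terms may be `⊥`; excluding `⊤` keeps the
subtractions legitimate, and the slack is shared term by term. -/
theorem exists_lt_sum_le_of_sum_lt {ι : Type*} (s : Finset ι) (t : ι → EReal)
    (ht : ∀ i ∈ s, t i ≠ ⊤) {w : ℝ} (h : ∑ i ∈ s, t i < w) :
    ∃ u : ι → ℝ, (∀ i ∈ s, t i < u i) ∧ ∑ i ∈ s, u i ≤ w := by
  classical
  induction s using Finset.induction_on generalizing w with
  | empty =>
    refine ⟨0, by simp, ?_⟩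
    simpa using (EReal.coe_lt_coe_iff.1 (by simpa using h : ((0 : ℝ) : EReal) < w)).le
  | insert a s ha ih =>
    rw [Finset.sum_insert ha] at h
    have hs : ∀ s' ⊆ s, ∑ i ∈ s', t i ≠ ⊤ := by
      intro s'
      induction s' using Finset.induction_on with
      | empty => simp
      | insert b s' hb ih' =>
        intro hsub
        rw [Finset.sum_insert hb]
        exact EReal.add_ne_top (ht b (Finset.mem_insert_of_mem (hsub (by simp))))
          (ih' ((Finset.subset_insert _ _).trans hsub))
    replace hs := hs s subset_rfl
    have hta := ht a (Finset.mem_insert_self a s)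
    have h1 : t a < w - ∑ i ∈ s, t i :=
      (EReal.lt_sub_iff_add_lt (.inr hta) (.inl hs)).2 h
    obtain ⟨p, hp1, hp2⟩ := EReal.lt_iff_exists_real_btwn.1 h1
    have h2 : (p : EReal) + ∑ i ∈ s, t i < w :=
      (EReal.lt_sub_iff_add_lt (.inr (EReal.coe_ne_top p)) (.inl hs)).1 hp2
    have h3 : ∑ i ∈ s, t i < ((w - p : ℝ) : EReal) := by
      rw [EReal.coe_sub]
      refine (EReal.lt_sub_iff_add_lt (.inl (EReal.coe_ne_bot p)) (.inl (EReal.coe_ne_top p))).2 ?_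
      rwa [add_comm]
    obtain ⟨u, hu1, hu2⟩ := ih (fun i hi => ht i (Finset.mem_insert_of_mem hi)) h3
    refine ⟨Function.update u a p, fun i hi => ?_, ?_⟩
    · by_cases hia : i = a
      · subst hia; simpa using hp1
      · rw [Function.update_of_ne hia]
        exact hu1 i ((Finset.mem_insert.1 hi).resolve_left hia)
    · rw [Finset.sum_insert ha, Function.update_self, Finset.sum_congr rfl fun i hi =>
        Function.update_of_ne (ne_of_mem_of_not_mem hi ha) p u]
      linarith

theorem exists_lt_le_sum_of_lt_sum {ι : Type*} (s : Finset ι) (t : ι → EReal)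
    (ht : ∀ i ∈ s, 0 ≤ t i) {w : ℝ} (h : w < ∑ i ∈ s, t i) :
    ∃ u : ι → ℝ, (∀ i ∈ s, u i < t i) ∧ w ≤ ∑ i ∈ s, u i := by
  classical
  have hneg : ∀ s : Finset ι, (∀ i ∈ s, 0 ≤ t i) → ∑ i ∈ s, -t i = -∑ i ∈ s, t i := by
    intro s hs
    induction s using Finset.induction_on with
    | empty => simp
    | insert b s hb ih =>
      have h0 : 0 ≤ ∑ i ∈ s, t i :=
        Finset.sum_nonneg fun i hi => hs i (Finset.mem_insert_of_mem hi)
      have hb0 : 0 ≤ t b := hs b (by simp)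
      rw [Finset.sum_insert hb, Finset.sum_insert hb, EReal.neg_add, sub_eq_add_neg,
        ih fun i hi => hs i (Finset.mem_insert_of_mem hi)]
      · exact .inl (fun hbot => by simp [hbot] at hb0)
      · exact .inr (fun hbot => by simp [hbot] at h0)
  obtain ⟨u, hu1, hu2⟩ := exists_lt_sum_le_of_sum_lt s (fun i => -t i) (w := -w)
    (fun i hi htop => by
      have := ht i hi
      rw [EReal.neg_eq_top_iff] at htop
      simp [htop] at this)
    (by rw [hneg s ht, EReal.coe_neg, EReal.neg_lt_neg_iff]; exact h)
  refine ⟨fun i => -u i, fun i hi => ?_, ?_⟩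
  · rw [EReal.coe_neg]
    exact EReal.neg_lt_comm.1 (hu1 i hi)
  · rw [Finset.sum_neg_distrib]
    linarith

end ERealSums

/-! ### Loop erasure. -/

section LoopErasure

/-- Loop erasure by last exits: a path from `a` to `b` contains, at distinct times, the steps of a
simple path from `a` to `b`. -/
theorem exists_simple_path {B : Type*} (x : ℕ → B) {L L' : ℕ} (hL : L ≤ L') :
    ∃ (k : ℕ) (l : Fin (k + 1) → B) (s : Fin k → ℕ), Function.Injective l ∧ l 0 = x L ∧
      l (Fin.last k) = x L' ∧ Function.Injective s ∧
      (∀ j, L < s j ∧ s j ≤ L' ∧ x (s j - 1) = l j.castSucc ∧ x (s j) = l j.succ) ∧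
      ∀ j, ∃ m, L ≤ m ∧ m ≤ L' ∧ x m = l j := by
  classical
  induction hd : L' - L using Nat.strong_induction_on generalizing L with
  | _ d ih =>
    by_cases hab : x L = x L'
    · exact ⟨0, fun _ => x L, Fin.elim0, fun i j _ => Subsingleton.elim (α := Fin 1) i j, rfl, hab,
        fun i => i.elim0, fun i => i.elim0, fun _ => ⟨L, le_rfl, hL, rfl⟩⟩
    -- After its last time `τ` at `x L`, the path never returns there, so the simple path extracted
    -- from time `τ + 1` on avoids `x L` and can be prefixed by it. The added step happens at time
    -- `τ + 1`.
    · set τ := Nat.findGreatest (fun m => x m = x L) L' with hτ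
      have hτ1 : x τ = x L := Nat.findGreatest_spec (P := fun m => x m = x L) hL rfl
      have hτ2 : L ≤ τ := Nat.le_findGreatest hL rfl
      have hτ3 : τ ≤ L' := Nat.findGreatest_le L'
      have hτ4 : τ ≠ L' := fun h => hab (by rw [← hτ1, h])
      have hτ5 : ∀ m, τ < m → m ≤ L' → x m ≠ x L := fun m h1 h2 =>
        Nat.findGreatest_is_greatest h1 h2
      obtain ⟨k, l, s, hl, hl0, hl1, hs, hsl, hm⟩ := ih (L' - (τ + 1)) (by omega)
        (L := τ + 1) (by omega) rfl
      refine ⟨k + 1, Fin.cons (x L) l, Fin.cons (τ + 1) s, ?_, rfl, ?_, ?_, ?_, ?_⟩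
      · rw [Fin.cons_injective_iff]
        refine ⟨?_, hl⟩
        rintro ⟨j, hj⟩
        obtain ⟨m, hm1, hm2, hm3⟩ := hm j
        exact hτ5 m (by omega) hm2 (hm3.trans hj)
      · rw [← hl1, ← Fin.succ_last, Fin.cons_succ]
      · rw [Fin.cons_injective_iff]
        refine ⟨?_, hs⟩
        rintro ⟨j, hj⟩
        have := (hsl j).1
        omega
      · intro j
        refine Fin.cases ?_ (fun j => ?_) j
        · refine ⟨?_, ?_, ?_, ?_⟩
          · simp only [Fin.cons_zero]; omega
          · simp only [Fin.cons_zero]; omega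
          · simpa using hτ1
          · simpa using hl0.symm
        · obtain ⟨h1, h2, h3, h4⟩ := hsl j
          refine ⟨?_, ?_, ?_, ?_⟩
          · simp only [Fin.cons_succ]; omega
          · simpa only [Fin.cons_succ] using h2
          · rw [← Fin.succ_castSucc, Fin.cons_succ, Fin.cons_succ]; exact h3
          · simpa only [Fin.cons_succ] using h4
      · intro j
        refine Fin.cases ⟨L, le_rfl, hL, rfl⟩ (fun j => ?_) j
        obtain ⟨m, hm1, hm2, hm3⟩ := hm j
        exact ⟨m, by omega, hm2, by simpa using hm3⟩

end LoopErasure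

/-! ### Probability of a passage between two blocks. -/

section Connection

variable {S : Type*} [Fintype S] {P : Matrix S S ℝ} {Q : ℕ → Matrix S S ℝ}

omit [Fintype S] in
theorem connProb_le_one (hQ1 : ∀ n, 1 ≤ n → ∀ i j, Q n i j ≤ 1) {n : ℕ} (hn : 1 ≤ n)
    (i j : Block P) : connProb Q n i j ≤ 1 :=
  iSup₂_le fun x _ => iSup₂_le fun y _ => ENNReal.ofReal_le_one.2 (hQ1 n hn x y)

/-- The largest entry from one block to another, as a real number. -/
noncomputable def connReal (Q : ℕ → Matrix S S ℝ) (n : ℕ) (i j : Block P) : ℝ :=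
  (connProb Q n i j).toReal

omit [Fintype S] in
theorem connReal_nonneg (n : ℕ) (i j : Block P) : 0 ≤ connReal Q n i j := ENNReal.toReal_nonneg

omit [Fintype S] in
theorem connReal_le_one (hQ1 : ∀ n, 1 ≤ n → ∀ i j, Q n i j ≤ 1) {n : ℕ} (hn : 1 ≤ n)
    (i j : Block P) : connReal Q n i j ≤ 1 :=
  ENNReal.toReal_le_of_le_ofReal zero_le_one (by simpa using connProb_le_one hQ1 hn i j)

omit [Fintype S] in
theorem le_connReal (hQ1 : ∀ n, 1 ≤ n → ∀ i j, Q n i j ≤ 1) {n : ℕ} (hn : 1 ≤ n)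
    (x y : S) : Q n x y ≤ connReal Q n (blockOf P x) (blockOf P y) := by
  have h1 : ENNReal.ofReal (Q n x y) ≤ connProb Q n (blockOf P x) (blockOf P y) :=
    le_iSup₂_of_le x (mem_states_iff.2 rfl) (le_iSup₂_of_le y (mem_states_iff.2 rfl) le_rfl)
  exact (ENNReal.ofReal_le_iff_le_toReal
    (ne_top_of_le_ne_top ENNReal.one_ne_top (connProb_le_one hQ1 hn _ _))).1 h1

omit [Fintype S] in
theorem upperConnRate_nonpos (hQ1 : ∀ n, 1 ≤ n → ∀ i j, Q n i j ≤ 1) (i j : Block P) :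
    upperConnRate Q i j ≤ 0 := by
  refine limsup_le_of_le (by isBoundedDefault) ?_
  filter_upwards [eventually_ge_atTop 1] with n hn
  refine EReal.mul_nonpos_iff.2 (.inl ⟨by exact_mod_cast (by positivity), ?_⟩)
  rw [← ENNReal.log_one]
  exact ENNReal.log_monotone (connProb_le_one hQ1 hn i j)

omit [Fintype S] in
theorem upperCost_nonpos (hQ1 : ∀ n, 1 ≤ n → ∀ i j, Q n i j ≤ 1) (i j : Block P) :
    upperCost P Q i j ≤ 0 :=
  iSup_le fun _ => iSup_le fun _ => iSup_le fun _ =>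
    Finset.sum_nonpos fun _ _ => upperConnRate_nonpos hQ1 _ _

omit [Fintype S] in
-- The limsup controls times from `n₀` on; earlier entries are at most `1`, and `C` absorbs them.
-- Truncating `u` at `0` makes the exponent nonincreasing in time, so a later time can be traded for
-- an earlier one.
theorem exists_connReal_le (hQ1 : ∀ n, 1 ≤ n → ∀ i j, Q n i j ≤ 1) {i j : Block P} {u : ℝ}
    (hu : upperConnRate Q i j < u) :
    ∃ C : ℝ, 1 ≤ C ∧ ∀ n, 1 ≤ n → connReal Q n i j ≤ C * Real.exp (n * min u 0) := by
  obtain ⟨n₀, hn₀⟩ := eventually_atTop.1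
    ((eventually_lt_of_limsup_lt hu).and (eventually_ge_atTop 1))
  refine ⟨Real.exp (n₀ * |min u 0|), Real.one_le_exp (by positivity), fun n hn => ?_⟩
  rw [← Real.exp_add]
  rcases le_total n₀ n with h | h
  · have h1 := (hn₀ n h).1
    have hn' : (0 : ℝ) < n := by exact_mod_cast hn
    have h2 : connReal Q n i j ≤ Real.exp (n * min u 0) := by
      rcases le_total u 0 with hu0 | hu0
      · rw [min_eq_left hu0]
        by_contra! hlt
        have hlt2 : ENNReal.ofReal (Real.exp (n * u)) < connProb Q n i j :=
          (ENNReal.ofReal_lt_iff_lt_toReal (Real.exp_pos _).le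
            (ne_top_of_le_ne_top ENNReal.one_ne_top (connProb_le_one hQ1 hn _ _))).2 hlt
        have h3 := ENNReal.log_monotone hlt2.le
        rw [ENNReal.log_ofReal_of_pos (Real.exp_pos _), Real.log_exp] at h3
        have h4 : ((1 / (n : ℝ) : ℝ) : EReal) * ((n * u : ℝ) : EReal) ≤
            ((1 / (n : ℝ) : ℝ) : EReal) * ENNReal.log (connProb Q n i j) :=
          mul_le_mul_of_nonneg_left h3 (by exact_mod_cast (by positivity))
        rw [← EReal.coe_mul, ← mul_assoc, one_div, inv_mul_cancel₀ hn'.ne', one_mul] at h4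
        rw [one_div] at h1
        exact absurd h1 (not_lt.2 h4)
      · rw [min_eq_right hu0]
        simpa using connReal_le_one hQ1 hn i j
    refine h2.trans (Real.exp_le_exp.2 ?_)
    have : 0 ≤ (n₀ : ℝ) * |min u 0| := by positivity
    linarith
  · refine (connReal_le_one hQ1 hn i j).trans (Real.one_le_exp ?_)
    have h1 : (n : ℝ) ≤ n₀ := by exact_mod_cast h
    have h2 := neg_abs_le (min u 0)
    nlinarith [abs_nonneg (min u 0), (Nat.cast_nonneg n : (0 : ℝ) ≤ n)]

omit [Fintype S] in
/-- Going from the block `a` to the block `b` after the time `L` costs at least `-L w`, for `w`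
above the routing rate. -/
theorem exists_connReal_prod_le_of_simple_path (hQ1 : ∀ n, 1 ≤ n → ∀ i j, Q n i j ≤ 1)
    {a b : Block P} {w : ℝ} (hw : upperCost P Q a b < w) {k : ℕ} (l : Fin (k + 2) → Block P)
    (hl : Function.Injective l ∧ l 0 = a ∧ l (Fin.last (k + 1)) = b) :
    ∃ C : ℝ, 1 ≤ C ∧ ∀ (L : ℕ) (s : Fin (k + 1) → ℕ), (∀ j, L < s j) →
      ∏ j, connReal Q (s j) (l j.castSucc) (l j.succ) ≤ C * Real.exp (L * w) := by
  have h1 : ∑ j : Fin (k + 1), upperConnRate Q (l j.castSucc) (l j.succ) < w :=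
    lt_of_le_of_lt (le_iSup_of_le k (le_iSup₂_of_le (f := fun (L : Fin (k + 2) → Block P)
      (_ : Function.Injective L ∧ L 0 = a ∧ L (Fin.last (k + 1)) = b) =>
      ∑ s : Fin (k + 1), upperConnRate Q (L s.castSucc) (L s.succ)) l hl le_rfl)) hw
  obtain ⟨u, hu1, hu2⟩ := exists_lt_sum_le_of_sum_lt _ _ (fun j _ htop => by
    have := upperConnRate_nonpos hQ1 (l j.castSucc) (l j.succ)
    simp [htop] at this) h1
  choose C hC1 hC2 using fun j => exists_connReal_le hQ1 (hu1 j (Finset.mem_univ j))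
  refine ⟨∏ j, C j, ?_, fun L s hs => ?_⟩
  · simpa using Finset.prod_le_prod (s := Finset.univ) (f := fun _ => (1 : ℝ))
      (fun _ _ => zero_le_one) (fun j _ => hC1 j)
  · calc ∏ j, connReal Q (s j) (l j.castSucc) (l j.succ)
        ≤ ∏ j, (C j * Real.exp (L * u j)) := by
          refine Finset.prod_le_prod (fun j _ => connReal_nonneg _ _ _) fun j _ => ?_
          refine (hC2 j (s j) (by have := hs j; omega)).trans ?_
          refine mul_le_mul_of_nonneg_left (Real.exp_le_exp.2 ?_) (zero_le_one.trans (hC1 j))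
          -- The truncated rate is nonpositive, so moving the time back from `s j` to `L` only
          -- weakens the bound.
          have h3 : (L : ℝ) ≤ s j := by exact_mod_cast (hs j).le
          exact (mul_le_mul_of_nonpos_right h3 (min_le_right _ _)).trans
            (mul_le_mul_of_nonneg_left (min_le_left _ _) (Nat.cast_nonneg L))
      _ = (∏ j, C j) * Real.exp (L * ∑ j, u j) := by
          rw [Finset.prod_mul_distrib, ← Real.exp_sum, Finset.mul_sum]
      _ ≤ (∏ j, C j) * Real.exp (L * w) := by
          refine mul_le_mul_of_nonneg_left (Real.exp_le_exp.2 ?_)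
            (Finset.prod_nonneg fun j _ => zero_le_one.trans (hC1 j))
          exact mul_le_mul_of_nonneg_left hu2 (Nat.cast_nonneg L)

/-- The marks are the times of the loop-erased steps. There are finitely many simple paths, so
summing their constants gives one constant for all passages. Rate `0` needs no marks, which is why
it is allowed even when it does not exceed the routing rate. -/
theorem exists_marks_of_passage (hQ1 : ∀ n, 1 ≤ n → ∀ i j, Q n i j ≤ 1)
    {a b : Block P} (hab : a ≠ b) {w : ℝ} (hw : w = 0 ∨ upperCost P Q a b < w) :
    ∃ C : ℝ, 1 ≤ C ∧ ∀ (x : ℕ → Block P) (L L' : ℕ), L ≤ L' → x L = a → x L' = b →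
      ∃ A : Finset ℕ, A ⊆ Finset.Ioc L L' ∧ A.card ≤ Fintype.card (Block P) ∧
        ∏ s ∈ A, connReal Q s (x (s - 1)) (x s) ≤ C * Real.exp (L * w) := by
  classical
  rcases hw with rfl | hw
  · exact ⟨1, le_rfl, fun x L L' _ _ _ => ⟨∅, by simp, by simp, by simp⟩⟩
  · have hex : ∀ (k : ℕ) (l : Fin (k + 2) → Block P), ∃ C : ℝ, 1 ≤ C ∧
        ((Function.Injective l ∧ l 0 = a ∧ l (Fin.last (k + 1)) = b) →
          ∀ (L : ℕ) (s : Fin (k + 1) → ℕ), (∀ j, L < s j) →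
          ∏ j, connReal Q (s j) (l j.castSucc) (l j.succ) ≤ C * Real.exp (L * w)) := by
      intro k l
      by_cases hl : Function.Injective l ∧ l 0 = a ∧ l (Fin.last (k + 1)) = b
      · obtain ⟨C, hC, h⟩ := exists_connReal_prod_le_of_simple_path hQ1 hw l hl
        exact ⟨C, hC, fun _ => h⟩
      · exact ⟨1, le_rfl, fun h => absurd h hl⟩
    choose C hC1 hC2 using hex
    have hsum0 : ∀ k, 0 ≤ ∑ l, C k l := fun k =>
      Finset.sum_nonneg fun l _ => zero_le_one.trans (hC1 k l)
    refine ⟨1 + ∑ k ∈ Finset.range (Fintype.card (Block P)), ∑ l, C k l, ?_,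
      fun x L L' hLL hxa hxb => ?_⟩
    · rw [le_add_iff_nonneg_right]
      exact Finset.sum_nonneg fun k _ => hsum0 k
    · obtain ⟨k, l, s, hl, hl0, hl1, hs, hsl, -⟩ := exists_simple_path x hLL
      have hcard : k + 1 ≤ Fintype.card (Block P) := by
        simpa using Fintype.card_le_of_injective l hl
      obtain _ | k := k
      · exact absurd (hxa.symm.trans (hl0.symm.trans (hl1.trans hxb))) hab
      · refine ⟨Finset.univ.image s, ?_, ?_, ?_⟩
        · intro t ht
          obtain ⟨j, -, rfl⟩ := Finset.mem_image.1 ht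
          exact Finset.mem_Ioc.2 ⟨(hsl j).1, (hsl j).2.1⟩
        · refine Finset.card_image_le.trans ?_
          simp only [Finset.card_univ, Fintype.card_fin]
          omega
        · rw [Finset.prod_image fun i _ j _ h => hs h]
          simp_rw [fun j => (hsl j).2.2.1, fun j => (hsl j).2.2.2]
          refine (hC2 k l ⟨hl, hl0.trans hxa, hl1.trans hxb⟩ L s fun j => (hsl j).1).trans ?_
          refine mul_le_mul_of_nonneg_right ?_ (Real.exp_pos _).le
          have h1 : C k l ≤ ∑ l, C k l := Finset.single_le_sum (f := fun l => C k l)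
            (fun l _ => zero_le_one.trans (hC1 k l)) (Finset.mem_univ l)
          have h2 : ∑ l, C k l ≤ ∑ k ∈ Finset.range (Fintype.card (Block P)), ∑ l, C k l :=
            Finset.single_le_sum (f := fun k => ∑ l, C k l) (fun k _ => hsum0 k)
              (Finset.mem_range.2 (by omega))
          linarith

end Connection

/-! ### Last visits and occupation times. -/

section Visits

variable {B : Type*} [DecidableEq B]

/-- The last visit of the path `x` to `b` up to the time `n` (`0` if there is none). -/
def lastVisit (x : ℕ → B) (n : ℕ) (b : B) : ℕ :=
  ((Finset.range (n + 1)).filter fun k => x k = b).sup id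

/-- The number of visits of the path `x` to `b` between the times `1` and `n`. -/
def visits (x : ℕ → B) (n : ℕ) (b : B) : ℕ := ((Finset.Icc 1 n).filter fun k => x k = b).card

theorem lastVisit_le (x : ℕ → B) (n : ℕ) (b : B) : lastVisit x n b ≤ n := by
  refine Finset.sup_le fun k hk => ?_
  have := Finset.mem_range.1 (Finset.mem_filter.1 hk).1
  simp only [id]
  omega

theorem le_lastVisit {x : ℕ → B} {n k : ℕ} (hk : k ≤ n) : k ≤ lastVisit x n (x k) :=
  Finset.le_sup (f := id) (Finset.mem_filter.2 ⟨Finset.mem_range.2 (by omega), rfl⟩)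

theorem apply_lastVisit {x : ℕ → B} {n : ℕ} {b : B} (h : lastVisit x n b ≠ 0) :
    x (lastVisit x n b) = b := by
  have hne : ((Finset.range (n + 1)).filter fun k => x k = b).Nonempty := by
    rw [Finset.nonempty_iff_ne_empty]
    rintro h0
    simp [lastVisit, h0] at h
  obtain ⟨k, hk, hk2⟩ := Finset.exists_mem_eq_sup _ hne id
  have h1 : lastVisit x n b = k := hk2
  rw [h1]
  exact (Finset.mem_filter.1 hk).2

/-- The visits to distinct blocks occupy disjoint sets of times, all contained in `{1, …, L}`. -/
theorem sum_visits_le {ι : Type*} (x : ℕ → B) (n L : ℕ) (σ : ι → B)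
    (hσ : Function.Injective σ) (s : Finset ι) (hs : ∀ j ∈ s, lastVisit x n (σ j) ≤ L) :
    ∑ j ∈ s, visits x n (σ j) ≤ L := by
  classical
  unfold visits
  rw [← Finset.card_biUnion]
  · refine (Finset.card_le_card (t := Finset.Icc 1 L) fun k hk => ?_).trans (by simp)
    obtain ⟨j, hj, hk⟩ := Finset.mem_biUnion.1 hk
    obtain ⟨hk1, hk2⟩ := Finset.mem_filter.1 hk
    obtain ⟨hk3, hk4⟩ := Finset.mem_Icc.1 hk1
    refine Finset.mem_Icc.2 ⟨hk3, le_trans ?_ (hs j hj)⟩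
    rw [← hk2]
    exact le_lastVisit hk4
  · intro i _ j _ hij
    refine Finset.disjoint_left.2 fun k hk hk' => hij (hσ ?_)
    exact (Finset.mem_filter.1 hk).2.symm.trans (Finset.mem_filter.1 hk').2

theorem sum_visits [Fintype B] (x : ℕ → B) (n : ℕ) : ∑ b, visits x n b = n := by
  unfold visits
  rw [← Finset.card_eq_sum_card_fiberwise (f := x) (fun _ _ => Finset.mem_coe.2 (Finset.mem_univ _))]
  simp

end Visits

/-! ### Marking the switches of a path. -/

section Marks

variable {S : Type*} [Fintype S] {P : Matrix S S ℝ} {Q : ℕ → Matrix S S ℝ}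

/-- The switching cost of the visiting order `σ` with rates `w`, for occupation times `v`. -/
noncomputable def switchScore (σ : Fin (numNondeg P) ≃ Nondeg P) (w : Fin (numNondeg P) → ℝ)
    (v : Block P → ℝ) : ℝ :=
  ∑ i : Fin (numNondeg P), if (i : ℕ) + 1 < numNondeg P then
    (∑ j ∈ Finset.Iic i, v (σ j).1) * w i else 0

/-- The rates `w` lie above the routing rates along the visiting order `σ`. -/
def AboveRouting (Q : ℕ → Matrix S S ℝ) (σ : Fin (numNondeg P) ≃ Nondeg P)
    (w : Fin (numNondeg P) → ℝ) : Prop :=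
  (∀ i, w i ≤ 0) ∧ ∀ (i : Fin (numNondeg P)) (h : (i : ℕ) + 1 < numNondeg P),
    w i = 0 ∨ upperCost P Q (σ i).1 (σ ⟨i + 1, h⟩).1 < w i

/-- A path visiting the blocks in the order `σ` of last visits makes, at a bounded number of
marked times, switches whose total probability is controlled by the occupation times. -/
theorem exists_marks (hQ1 : ∀ n, 1 ≤ n → ∀ i j, Q n i j ≤ 1)
    (σ : Fin (numNondeg P) ≃ Nondeg P) {w : Fin (numNondeg P) → ℝ} (hw : AboveRouting Q σ w) :
    ∃ (C : ℝ) (m : ℕ), 0 ≤ C ∧ ∀ (x : ℕ → Block P) (n : ℕ),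
      Monotone (fun i => lastVisit x n (σ i).1) →
      ∃ A : Finset ℕ, A ⊆ Finset.Icc 1 n ∧ A.card ≤ m ∧
        ∏ s ∈ A, connReal Q s (x (s - 1)) (x s) ≤
          C * Real.exp (switchScore σ w fun b => visits x n b) := by
  classical
  have hinj : Function.Injective fun i => (σ i).1 := Subtype.val_injective.comp σ.injective
  have hstep : ∀ i : Fin (numNondeg P), ∃ C : ℝ, 0 ≤ C ∧ ∀ (x : ℕ → Block P) (n : ℕ),
      Monotone (fun i => lastVisit x n (σ i).1) →
      ∃ A : Finset ℕ, A ⊆ Finset.Ioc (lastVisit x n (σ i).1) n ∧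
        (∀ j, i < j → ∀ s ∈ A, s ≤ lastVisit x n (σ j).1) ∧
        A.card ≤ Fintype.card (Block P) ∧
        ∏ s ∈ A, connReal Q s (x (s - 1)) (x s) ≤
          C * Real.exp (if (i : ℕ) + 1 < numNondeg P then
            (∑ j ∈ Finset.Iic i, (visits x n (σ j).1 : ℝ)) * w i else 0) := by
    intro i
    by_cases hi : (i : ℕ) + 1 < numNondeg P
    · have hne : (σ i).1 ≠ (σ ⟨i + 1, hi⟩).1 := fun h => by
        have := congrArg Fin.val (hinj h)
        simp at this
      obtain ⟨C, hC1, hC⟩ := exists_marks_of_passage hQ1 hne (hw.2 i hi)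
      refine ⟨C, zero_le_one.trans hC1, fun x n hmono => ?_⟩
      simp only [hi, if_true]
      have hcum : ∑ j ∈ Finset.Iic i, (visits x n (σ j).1 : ℝ) ≤ lastVisit x n (σ i).1 := by
        exact_mod_cast sum_visits_le x n _ (fun i => (σ i).1) hinj _
          fun j hj => hmono (Finset.mem_Iic.1 hj)
      -- The value `0` may be a default, so the path need not be in `σ i` at that time. The counted
      -- visits then vanish and no marks are needed; otherwise both last visits are genuine.
      by_cases h0 : lastVisit x n (σ i).1 = 0
      · refine ⟨∅, by simp, by simp, by simp, ?_⟩
        have hz : ∑ j ∈ Finset.Iic i, (visits x n (σ j).1 : ℝ) = 0 := by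
          refine le_antisymm (hcum.trans (by simp [h0])) (by positivity)
        simpa [hz] using hC1
      · have hle : lastVisit x n (σ i).1 ≤ lastVisit x n (σ ⟨i + 1, hi⟩).1 :=
          hmono (show i ≤ ⟨i + 1, hi⟩ from Fin.le_def.2 (by simp))
        obtain ⟨A, hA1, hA2, hA3⟩ := hC x _ _ hle (apply_lastVisit h0)
          (apply_lastVisit (by omega))
        refine ⟨A, hA1.trans (Finset.Ioc_subset_Ioc_right (lastVisit_le _ _ _)),
          fun j hj s hs => ?_, hA2, hA3.trans ?_⟩
        · refine (Finset.mem_Ioc.1 (hA1 hs)).2.trans (hmono ?_)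
          exact Fin.le_def.2 (Nat.succ_le_of_lt (Fin.lt_def.1 hj))
        · refine mul_le_mul_of_nonneg_left (Real.exp_le_exp.2 ?_) (zero_le_one.trans hC1)
          -- The occupation time is at most the last visit and the rate is nonpositive, so the bound
          -- survives the replacement.
          exact mul_le_mul_of_nonpos_right hcum (hw.1 i)
    · refine ⟨1, zero_le_one, fun x n _ => ⟨∅, by simp, by simp, by simp, by simp [hi]⟩⟩
  choose C hC0 hC using hstep
  refine ⟨∏ i, C i, numNondeg P * Fintype.card (Block P), Finset.prod_nonneg fun i _ => hC0 i,
    fun x n hmono => ?_⟩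
  choose A hA1 hA2 hA3 hA4 using fun i => hC i x n hmono
  -- The marks of a passage lie after one last visit and no later than the next, so different
  -- passages have disjoint marks and their bounds multiply.
  have hdisj : ∀ i j, i < j → Disjoint (A i) (A j) := fun i j hij =>
    Finset.disjoint_left.2 fun s hs hs' => by
      have h1 := hA2 i j hij s hs
      have h2 := (Finset.mem_Ioc.1 (hA1 j hs')).1
      omega
  refine ⟨Finset.univ.biUnion A, ?_, ?_, ?_⟩
  · refine Finset.biUnion_subset.2 fun i _ s hs => ?_
    have := Finset.mem_Ioc.1 (hA1 i hs)
    exact Finset.mem_Icc.2 ⟨by omega, this.2⟩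
  · refine (Finset.card_biUnion_le_card_mul _ _ _ fun i _ => hA3 i).trans ?_
    simp
  · rw [Finset.prod_biUnion fun i _ j _ hij => (lt_or_gt_of_ne hij).elim (hdisj i j)
      fun h => (hdisj j i h).symm, switchScore, Real.exp_sum, ← Finset.prod_mul_distrib]
    exact Finset.prod_le_prod (fun i _ => Finset.prod_nonneg fun s _ => connReal_nonneg _ _ _)
      fun i _ => hA4 i

end Marks

/-! ### Exponential bound for paths of large score. -/

section Score

variable {S : Type*} [Fintype S] {P : Matrix S S ℝ} {Q : ℕ → Matrix S S ℝ} {d : ℕ}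

/-- The parameters of an exponential bound: a tilt and a rate for each block, and rates for the
switches along an order of visits. -/
structure Tilt (P : Matrix S S ℝ) (d : ℕ) where
  /-- The tilts. -/
  lam : Block P → EuclideanSpace ℝ (Fin d)
  /-- The growth rates. -/
  rad : Block P → ℝ
  /-- The switching rates. -/
  rate : Fin (numNondeg P) → ℝ

/-- The growth rates exceed the Perron roots and the switching rates exceed the routing rates. -/
structure Tilt.Admissible (θ : Tilt P d) (Q : ℕ → Matrix S S ℝ) (f : S → EuclideanSpace ℝ (Fin d))
    (σ : Fin (numNondeg P) ≃ Nondeg P) : Prop where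
  rad_pos : ∀ b, 0 < θ.rad b
  root_lt : ∀ b : Block P, tiltedRoot P f b.states (θ.lam b) < ENNReal.ofReal (θ.rad b)
  above : AboveRouting Q σ θ.rate

/-- The exponent of the bound, for occupation times `p.1` and block sums `p.2`. -/
noncomputable def Tilt.score (θ : Tilt P d) (σ : Fin (numNondeg P) ≃ Nondeg P)
    (p : (Block P → ℝ) × (Block P → EuclideanSpace ℝ (Fin d))) : ℝ :=
  ∑ b, (inner ℝ (θ.lam b) (p.2 b) - p.1 b * Real.log (θ.rad b)) - switchScore σ θ.rate p.1

theorem Tilt.score_smul (θ : Tilt P d) (σ : Fin (numNondeg P) ≃ Nondeg P) (c : ℝ)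
    (p : (Block P → ℝ) × (Block P → EuclideanSpace ℝ (Fin d))) :
    θ.score σ (c • p) = c * θ.score σ p := by
  simp only [Tilt.score, switchScore, Prod.smul_fst, Prod.smul_snd, Pi.smul_apply, smul_eq_mul,
    inner_smul_right, mul_sub, Finset.mul_sum, mul_ite, mul_zero, Finset.sum_mul, mul_assoc]

theorem Tilt.continuous_score (θ : Tilt P d) (σ : Fin (numNondeg P) ≃ Nondeg P) :
    Continuous (θ.score σ) := by
  unfold Tilt.score switchScore
  refine Continuous.sub (by fun_prop) (continuous_finsetSum _ fun i _ => ?_)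
  split_ifs <;> fun_prop

/-- The occupation times of the blocks between the times `1` and `n`, and the sums of `f` over the
visits. -/
noncomputable def blockTotals (P : Matrix S S ℝ) (f : S → EuclideanSpace ℝ (Fin d)) (n : ℕ)
    (x : ℕ → S) : (Block P → ℝ) × (Block P → EuclideanSpace ℝ (Fin d)) :=
  (fun b => visits (fun k => blockOf P (x k)) n b,
    fun b => ∑ k ∈ Finset.Icc 1 n with blockOf P (x k) = b, f (x k))

theorem prod_gain_eq (f : S → EuclideanSpace ℝ (Fin d)) (θ : Tilt P d)
    (hr : ∀ b, 0 < θ.rad b) (n : ℕ) (x : ℕ → S) (σ : Fin (numNondeg P) ≃ Nondeg P) :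
    ∏ k ∈ Finset.range n, gain f θ.lam θ.rad (x (k + 1)) =
      Real.exp (θ.score σ (blockTotals P f n x) +
        switchScore σ θ.rate (blockTotals P f n x).1) := by
  have h1 : ∀ y, gain f θ.lam θ.rad y =
      Real.exp (inner ℝ (θ.lam (blockOf P y)) (f y) - Real.log (θ.rad (blockOf P y))) := by
    intro y
    rw [Real.exp_sub, Real.exp_log (hr _), gain]
  simp_rw [h1]
  rw [← Real.exp_sum, Tilt.score, sub_add_cancel]
  congr 1
  have h2 : ∑ k ∈ Finset.range n, (inner ℝ (θ.lam (blockOf P (x (k + 1)))) (f (x (k + 1))) -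
      Real.log (θ.rad (blockOf P (x (k + 1))))) =
      ∑ k ∈ Finset.Icc 1 n, (inner ℝ (θ.lam (blockOf P (x k))) (f (x k)) -
        Real.log (θ.rad (blockOf P (x k)))) := by
    rw [← Finset.Ico_add_one_right_eq_Icc, Finset.sum_Ico_eq_sum_range]
    refine Finset.sum_congr (by simp) fun k _ => ?_
    rw [add_comm 1 k]
  rw [h2, ← Finset.sum_fiberwise (Finset.Icc 1 n) (fun k => blockOf P (x k))]
  refine Finset.sum_congr rfl fun b _ => ?_
  simp only [blockTotals, visits, inner_sum]
  rw [← nsmul_eq_mul, ← Finset.sum_const, ← Finset.sum_sub_distrib]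
  refine Finset.sum_congr rfl fun k hk => ?_
  rw [(Finset.mem_filter.1 hk).2]

/-- Polynomially many sets of marks: a union bound over them is free on the exponential scale. -/
theorem card_marks_le (n m : ℕ) :
    (((Finset.Icc 1 n).powerset.filter fun A => A.card ≤ m).card : ℝ) ≤
      (m + 1) * ((n : ℝ) + 1) ^ m := by
  have h1 : (Finset.Icc 1 n).powerset.filter (fun A => A.card ≤ m) ⊆
      (Finset.range (m + 1)).biUnion fun j => (Finset.Icc 1 n).powersetCard j := by
    intro A hA
    obtain ⟨h1, h2⟩ := Finset.mem_filter.1 hA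
    exact Finset.mem_biUnion.2 ⟨A.card, Finset.mem_range.2 (by omega),
      Finset.mem_powersetCard.2 ⟨Finset.mem_powerset.1 h1, rfl⟩⟩
  have h2 : ((Finset.Icc 1 n).powerset.filter fun A => A.card ≤ m).card ≤
      (m + 1) * (n + 1) ^ m := by
    refine (Finset.card_le_card h1).trans ((Finset.card_biUnion_le_card_mul _ _ ((n + 1) ^ m)
      fun j hj => ?_).trans (by simp))
    rw [Finset.card_powersetCard, Nat.card_Icc, Nat.add_sub_cancel]
    refine (Nat.choose_le_pow n j).trans ((Nat.pow_le_pow_left (Nat.le_succ n) j).trans ?_)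
    exact Nat.pow_le_pow_right (Nat.succ_pos n) (Nat.lt_succ_iff.1 (Finset.mem_range.1 hj))
  exact_mod_cast h2

open Classical in
/-- The weight of the paths whose score is at least `a`. -/
theorem exists_sum_paths_score_le (hP : ∀ i j, 0 ≤ P i j)
    (hQ0 : ∀ n, 1 ≤ n → ∀ i j, 0 ≤ Q n i j) (hQ1 : ∀ n, 1 ≤ n → ∀ i j, Q n i j ≤ 1)
    (hlim : ∀ i j, Tendsto (fun n => Q n i j) atTop (𝓝 (P i j)))
    (f : S → EuclideanSpace ℝ (Fin d)) (σ : Fin (numNondeg P) ≃ Nondeg P) {θ : Tilt P d}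
    (hθ : θ.Admissible Q f σ) (a : ℝ) :
    ∃ (C : ℝ) (m : ℕ), 0 ≤ C ∧ ∀ n : ℕ, 1 ≤ n →
      ∑ x : Fin (n + 1) → S with
        (Monotone (fun i => lastVisit (fun k => blockOf P (extPath x k)) n (σ i).1) ∧
          a ≤ θ.score σ ((1 / (n : ℝ)) • blockTotals P f n (extPath x))),
        ∏ k ∈ Finset.range n, Q (k + 1) (extPath x k) (extPath x (k + 1)) ≤
      C * ((n : ℝ) + 1) ^ m * Real.exp (-(n * a)) := by
  obtain ⟨h, h1, hh⟩ := exists_strict_superharmonic hP hθ.rad_pos hθ.root_lt (f := f)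
  have hev : ∀ᶠ n in atTop, ∀ x, ∑ y, Q n x y * (gain f θ.lam θ.rad y * h y) ≤ h x := by
    refine eventually_all.2 fun x => ?_
    have ht : Tendsto (fun n => ∑ y, Q n x y * (gain f θ.lam θ.rad y * h y)) atTop
        (𝓝 (∑ y, P x y * (gain f θ.lam θ.rad y * h y))) :=
      tendsto_finsetSum _ fun y _ => (hlim x y).mul_const _
    exact (ht.eventually (gt_mem_nhds (hh x))).mono fun n hn => hn.le
  obtain ⟨C₁, K, hC₁, hK, hsum⟩ := sum_paths_erased_le hQ0 hQ1 (gain f θ.lam θ.rad)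
    (gain_pos hθ.rad_pos) h h1 hev
  obtain ⟨C₂, m, hC₂, hmarks⟩ := exists_marks hQ1 σ hθ.above
  refine ⟨C₂ * (C₁ * K ^ m) * (m + 1), m, by positivity, fun n hn => ?_⟩
  set T : Finset (Finset ℕ) := (Finset.Icc 1 n).powerset.filter fun A => A.card ≤ m with hT
  set W : Finset ℕ → (Fin (n + 1) → S) → ℝ := fun A x => ∏ k ∈ Finset.range n,
    (if k + 1 ∈ A then 1 else Q (k + 1) (extPath x k) (extPath x (k + 1))) *
      gain f θ.lam θ.rad (extPath x (k + 1)) with hW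
  have hW0 : ∀ A x, 0 ≤ W A x := fun A x => Finset.prod_nonneg fun k _ => mul_nonneg
    (by split_ifs; exacts [zero_le_one, hQ0 _ (by omega) _ _]) (gain_pos hθ.rad_pos _).le
  have hpath : ∀ x : Fin (n + 1) → S,
      Monotone (fun i => lastVisit (fun k => blockOf P (extPath x k)) n (σ i).1) →
      a ≤ θ.score σ ((1 / (n : ℝ)) • blockTotals P f n (extPath x)) →
      ∏ k ∈ Finset.range n, Q (k + 1) (extPath x k) (extPath x (k + 1)) ≤
        ∑ A ∈ T, C₂ * Real.exp (-(n * a)) * W A x := by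
    intro x hmono ha
    obtain ⟨A, hA1, hA2, hA3⟩ := hmarks _ n hmono
    refine le_trans ?_ (Finset.single_le_sum (f := fun A => C₂ * Real.exp (-(n * a)) * W A x)
      (fun A _ => mul_nonneg (by positivity) (hW0 A x))
      (Finset.mem_filter.2 ⟨Finset.mem_powerset.2 hA1, hA2⟩))
    have hn' : (0 : ℝ) < n := by exact_mod_cast hn
    have hsc : n * a ≤ θ.score σ (blockTotals P f n (extPath x)) := by
      rw [Tilt.score_smul, one_div, inv_mul_eq_div, le_div_iff₀ hn'] at ha
      linarith
    simp only [hW]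
    rw [Finset.prod_mul_distrib, prod_gain_eq f θ hθ.rad_pos n _ σ]
    -- Marked factors are estimated pathwise; unmarked ones are kept for the sum over all paths.
    have hsplit : ∏ k ∈ Finset.range n, Q (k + 1) (extPath x k) (extPath x (k + 1)) =
        (∏ k ∈ Finset.range n, if k + 1 ∈ A then 1
          else Q (k + 1) (extPath x k) (extPath x (k + 1))) *
        ∏ k ∈ Finset.range n, if k + 1 ∈ A then
          Q (k + 1) (extPath x k) (extPath x (k + 1)) else 1 := by
      rw [← Finset.prod_mul_distrib]
      exact Finset.prod_congr rfl fun k _ => by split_ifs <;> simp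
    have hmark : ∏ k ∈ Finset.range n, (if k + 1 ∈ A then
          Q (k + 1) (extPath x k) (extPath x (k + 1)) else 1) ≤
        C₂ * Real.exp (switchScore σ θ.rate (blockTotals P f n (extPath x)).1) := by
      refine le_trans ?_ hA3
      rw [← Finset.prod_filter]
      have himg : A = ((Finset.range n).filter fun k => k + 1 ∈ A).image fun k => k + 1 := by
        ext s
        simp only [Finset.mem_image, Finset.mem_filter, Finset.mem_range]
        constructor
        · intro hs
          have := Finset.mem_Icc.1 (hA1 hs)
          exact ⟨s - 1, ⟨by omega, by rwa [Nat.sub_add_cancel this.1]⟩, Nat.sub_add_cancel this.1⟩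
        · rintro ⟨k, ⟨_, hk⟩, rfl⟩
          exact hk
      conv_rhs => rw [himg]
      rw [Finset.prod_image fun i _ j _ hij => by simpa using hij]
      exact Finset.prod_le_prod (fun k _ => hQ0 _ (by omega) _ _)
        fun k _ => le_connReal hQ1 (by omega) _ _
    have herase0 : 0 ≤ ∏ k ∈ Finset.range n, if k + 1 ∈ A then 1
          else Q (k + 1) (extPath x k) (extPath x (k + 1)) :=
      Finset.prod_nonneg fun k _ => by split_ifs; exacts [zero_le_one, hQ0 _ (by omega) _ _]
    rw [hsplit, Real.exp_add]
    set E := ∏ k ∈ Finset.range n, if k + 1 ∈ A then 1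
          else Q (k + 1) (extPath x k) (extPath x (k + 1))
    set s₁ := θ.score σ (blockTotals P f n (extPath x))
    set s₂ := Real.exp (switchScore σ θ.rate (blockTotals P f n (extPath x)).1)
    -- The marked factors supply `s₂` and the lower bound on the score supplies `exp s₁`; together
    -- these are the product of the gains.
    have hone : 1 ≤ Real.exp (-(n * a)) * Real.exp s₁ := by
      rw [← Real.exp_add]
      exact Real.one_le_exp (by linarith)
    calc E * _ ≤ E * (C₂ * s₂) := mul_le_mul_of_nonneg_left hmark herase0
      _ ≤ E * (C₂ * s₂) * (Real.exp (-(n * a)) * Real.exp s₁) :=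
          le_mul_of_one_le_right (mul_nonneg herase0 (by positivity)) hone
      _ = _ := by ring
  calc _ ≤ ∑ x : Fin (n + 1) → S with
        (Monotone (fun i => lastVisit (fun k => blockOf P (extPath x k)) n (σ i).1) ∧
          a ≤ θ.score σ ((1 / (n : ℝ)) • blockTotals P f n (extPath x))),
        ∑ A ∈ T, C₂ * Real.exp (-(n * a)) * W A x :=
        Finset.sum_le_sum fun x hx => hpath x (Finset.mem_filter.1 hx).2.1
          (Finset.mem_filter.1 hx).2.2
    _ ≤ ∑ x : Fin (n + 1) → S, ∑ A ∈ T, C₂ * Real.exp (-(n * a)) * W A x :=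
        Finset.sum_le_univ_sum_of_nonneg fun x => Finset.sum_nonneg fun A _ =>
          mul_nonneg (by positivity) (hW0 A x)
    _ = ∑ A ∈ T, C₂ * Real.exp (-(n * a)) * ∑ x : Fin (n + 1) → S, W A x := by
        rw [Finset.sum_comm]
        simp_rw [Finset.mul_sum]
    _ ≤ ∑ A ∈ T, C₂ * Real.exp (-(n * a)) * (C₁ * K ^ m) := by
        refine Finset.sum_le_sum fun A hA => mul_le_mul_of_nonneg_left ?_ (by positivity)
        refine (hsum A n).trans (mul_le_mul_of_nonneg_left ?_ (by positivity))
        exact pow_le_pow_right₀ hK (Finset.mem_filter.1 hA).2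
    _ = (T.card : ℝ) * (C₂ * Real.exp (-(n * a)) * (C₁ * K ^ m)) := by
        rw [Finset.sum_const, nsmul_eq_mul]
    _ ≤ ((m + 1) * ((n : ℝ) + 1) ^ m) * (C₂ * Real.exp (-(n * a)) * (C₁ * K ^ m)) :=
        mul_le_mul_of_nonneg_right (card_marks_le n m) (by positivity)
    _ = _ := by ring

end Score

/-! ### Costs as suprema of scores. -/

section Costs

variable {S : Type*} [Fintype S] {P : Matrix S S ℝ} {Q : ℕ → Matrix S S ℝ} {d : ℕ}
  {f : S → EuclideanSpace ℝ (Fin d)}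

theorem tiltedRoot_zero_le_one (hP : ∀ i j, 0 ≤ P i j) (hP1 : ∀ i, ∑ j, P i j = 1) (C : Set S) :
    tiltedRoot P f C 0 ≤ 1 := by
  have h := tiltedRoot_le hP hP1 f C 0 (F := ∑ s, ‖f s‖)
    fun s => Finset.single_le_sum (f := fun s => ‖f s‖) (fun _ _ => norm_nonneg _)
      (Finset.mem_univ s)
  simpa using h

theorem tiltedRoot_zero_lt_two (hP : ∀ i j, 0 ≤ P i j) (hP1 : ∀ i, ∑ j, P i j = 1) (C : Set S) :
    tiltedRoot P f C 0 < ENNReal.ofReal 2 :=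
  (tiltedRoot_zero_le_one hP hP1 C).trans_lt (by simp)

theorem restCost_nonneg (hP : ∀ i j, 0 ≤ P i j) (hP1 : ∀ i, ∑ j, P i j = 1) (C : Set S)
    (x : EuclideanSpace ℝ (Fin d)) : 0 ≤ restCost P f C x := by
  rw [restCost_eq]
  refine le_iSup_of_le 0 ?_
  rw [inner_zero_left, EReal.coe_zero, zero_sub, EReal.le_neg, neg_zero, ← ENNReal.log_one]
  exact ENNReal.log_monotone (tiltedRoot_zero_le_one hP hP1 C)

/-- Testing with the tilt `t • x` gives at least `t * ‖x‖ * (‖x‖ - F)`, unbounded in `t` when `‖x‖ >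
F`. -/
theorem norm_le_of_restCost_ne_top (hP : ∀ i j, 0 ≤ P i j) (hP1 : ∀ i, ∑ j, P i j = 1)
    {C : Set S} {x : EuclideanSpace ℝ (Fin d)} {F : ℝ} (hF : ∀ s, ‖f s‖ ≤ F)
    (h : restCost P f C x ≠ ⊤) : ‖x‖ ≤ F := by
  by_contra! hlt
  have hrc : ∀ t : ℝ, 0 ≤ t → ((t * (‖x‖ * (‖x‖ - F)) : ℝ) : EReal) ≤ restCost P f C x := by
    intro t ht
    rw [restCost_eq]
    refine le_iSup_of_le (t • x) ?_
    have h1 := ENNReal.log_monotone (tiltedRoot_le hP hP1 f C (t • x) hF)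
    rw [ENNReal.log_ofReal_of_pos (Real.exp_pos _), Real.log_exp] at h1
    refine le_trans (le_of_eq ?_) (EReal.sub_le_sub le_rfl h1)
    rw [← EReal.coe_sub, real_inner_smul_left, real_inner_self_eq_norm_sq, norm_smul,
      Real.norm_of_nonneg ht]
    congr 1
    ring
  have hx : 0 < ‖x‖ := by
    by_contra! hx
    have hx0 : ‖x‖ = 0 := le_antisymm hx (norm_nonneg _)
    -- Without states `F` may be negative and `x` zero; the Perron root is then `0`, so the resting
    -- cost is `⊤` anyway.
    by_cases hne : Nonempty S
    · obtain ⟨s⟩ := hne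
      have := (norm_nonneg _).trans (hF s)
      linarith
    · have hrow : tiltedRoot P f C 0 = 0 := by
        classical
        have h0 : tilted P f C 0 = 0 := by ext i; exact absurd ⟨i.1⟩ hne
        rw [tiltedRoot, h0]
        exact perronRoot_zero
      refine h (top_le_iff.1 ?_)
      rw [restCost_eq]
      refine le_iSup_of_le 0 ?_
      simp [hrow]
  refine h (EReal.eq_top_iff_forall_lt _ |>.2 fun y => ?_)
  have hpos : 0 < ‖x‖ * (‖x‖ - F) := mul_pos hx (by linarith)
  refine lt_of_lt_of_le ?_ (hrc ((|y| + 1) / (‖x‖ * (‖x‖ - F))) (by positivity))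
  rw [div_mul_cancel₀ _ hpos.ne', EReal.coe_lt_coe_iff]
  linarith [le_abs_self y]

/-- A real lower bound of a resting cost is attained by some tilt. -/
theorem exists_tilt_of_lt_restCost (hP : ∀ i j, 0 ≤ P i j) (hP1 : ∀ i, ∑ j, P i j = 1)
    {C : Set S} {u v : ℝ} (hv : 0 ≤ v) {x : EuclideanSpace ℝ (Fin d)}
    (h : (u : EReal) < (v : EReal) * restCost P f C x) :
    ∃ (lam : EuclideanSpace ℝ (Fin d)) (r : ℝ), 0 < r ∧ tiltedRoot P f C lam < ENNReal.ofReal r ∧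
      u ≤ inner ℝ lam (v • x) - v * Real.log r := by
  -- At weight zero the convention `0 * ⊤ = 0` forces `u < 0`, and any admissible tilt works.
  rcases hv.eq_or_lt with rfl | hv
  · refine ⟨0, 2, two_pos, tiltedRoot_zero_lt_two hP hP1 C, ?_⟩
    rw [EReal.coe_zero, zero_mul] at h
    have : u < 0 := by exact_mod_cast h
    simpa using this.le
  · have h1 : ((u / v : ℝ) : EReal) < restCost P f C x := by
      by_contra! hle
      have h2 := mul_le_mul_of_nonneg_left hle (show (0 : EReal) ≤ (v : EReal) by
        exact_mod_cast hv.le)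
      rw [← EReal.coe_mul, mul_div_cancel₀ _ hv.ne'] at h2
      exact absurd h (not_lt.2 h2)
    rw [restCost_eq, lt_iSup_iff] at h1
    obtain ⟨lam, hlam⟩ := h1
    have h3 : ENNReal.log (tiltedRoot P f C lam) < ((inner ℝ lam x - u / v : ℝ) : EReal) := by
      by_contra! hle
      have h4 := EReal.sub_le_sub (le_refl ((inner ℝ lam x : ℝ) : EReal)) hle
      rw [← EReal.coe_sub, sub_sub_cancel] at h4
      exact absurd hlam (not_lt.2 h4)
    refine ⟨lam, Real.exp (inner ℝ lam x - u / v), Real.exp_pos _, ?_, ?_⟩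
    · rw [← ENNReal.log_strictMono.lt_iff_lt, ENNReal.log_ofReal_of_pos (Real.exp_pos _),
        Real.log_exp]
      exact h3
    · rw [Real.log_exp, real_inner_smul_right]
      have : v * (u / v) = u := mul_div_cancel₀ _ hv.ne'
      linarith

/-- A real lower bound of a switching cost is attained by some rate above the routing rate. -/
theorem exists_rate_of_lt_mul {u c : ℝ} {U : EReal} (hc : 0 ≤ c)
    (h : (u : EReal) < -((c : EReal) * U)) :
    ∃ w : ℝ, w ≤ 0 ∧ (w = 0 ∨ U < w) ∧ u ≤ -(c * w) := by
  rcases lt_or_ge u 0 with hu | hu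
  · exact ⟨0, le_rfl, .inl rfl, by simpa using hu.le⟩
  · have hc' : 0 < c := by
      refine lt_of_le_of_ne hc ?_
      rintro rfl
      rw [EReal.coe_zero, zero_mul, neg_zero] at h
      exact absurd (by exact_mod_cast h : u < 0) (not_lt.2 hu)
    have h1 : U < ((-u / c : ℝ) : EReal) := by
      by_contra! hle
      have h2 := mul_le_mul_of_nonneg_left hle (show (0 : EReal) ≤ (c : EReal) by
        exact_mod_cast hc)
      rw [← EReal.coe_mul, mul_div_cancel₀ _ hc'.ne'] at h2
      have h3 := EReal.neg_le_neg_iff.2 h2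
      rw [← EReal.coe_neg, neg_neg] at h3
      exact absurd h (not_lt.2 h3)
    obtain ⟨w, hw1, hw2⟩ := EReal.lt_iff_exists_real_btwn.1 h1
    have hw3 : w < -u / c := by exact_mod_cast hw2
    refine ⟨w, hw3.le.trans (div_nonpos_of_nonpos_of_nonneg (by linarith) hc), .inr hw1, ?_⟩
    rw [lt_div_iff₀ hc'] at hw3
    linarith

omit [Fintype S] in
/-- Sums along an enumeration of the nondegenerate blocks. -/
theorem sum_nondeg {N : ℕ} {E : Type*} [AddCommMonoid E] [Fintype (Block P)]
    (σ : Fin N ≃ Nondeg P) (g : Block P → E)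
    (hg : ∀ b : Block P, ¬ (block P b.states).IsIrreducible → g b = 0) :
    ∑ i, g (σ i).1 = ∑ b, g b := by
  refine Fintype.sum_of_injective (fun i => (σ i).1)
    (Subtype.val_injective.comp σ.injective) _ _ (fun b hb => hg b fun h => hb ?_) fun i => rfl
  exact ⟨σ.symm ⟨b, h⟩, congrArg Subtype.val (σ.apply_symm_apply ⟨b, h⟩)⟩

omit [Fintype S] in
theorem switch_term_nonneg (hQ1 : ∀ n, 1 ≤ n → ∀ i j, Q n i j ≤ 1) {c : ℝ} (hc : 0 ≤ c)
    (i j : Block P) : 0 ≤ -((c : EReal) * upperCost P Q i j) := by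
  rw [EReal.le_neg, neg_zero]
  exact EReal.mul_nonpos_iff.2 (.inl ⟨by exact_mod_cast hc, upperCost_nonpos hQ1 _ _⟩)

theorem rest_term_nonneg (hP : ∀ i j, 0 ≤ P i j) (hP1 : ∀ i, ∑ j, P i j = 1) {v : ℝ} (hv : 0 ≤ v)
    (C : Set S) (x : EuclideanSpace ℝ (Fin d)) : 0 ≤ (v : EReal) * restCost P f C x :=
  mul_nonneg (by exact_mod_cast hv) (restCost_nonneg hP hP1 C x)

theorem pathCost_nonneg (hP : ∀ i j, 0 ≤ P i j) (hP1 : ∀ i, ∑ j, P i j = 1)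
    (hQ1 : ∀ n, 1 ≤ n → ∀ i j, Q n i j ≤ 1) {v : Fin (numNondeg P) → ℝ} (hv : ∀ i, 0 ≤ v i)
    (σ : Fin (numNondeg P) ≃ Nondeg P) (x : Fin (numNondeg P) → EuclideanSpace ℝ (Fin d)) :
    0 ≤ pathCost P f (upperCost P Q) v σ x := by
  refine add_nonneg (Finset.sum_nonneg fun i _ => ?_) (Finset.sum_nonneg fun i _ =>
    rest_term_nonneg hP hP1 (hv i) _ _)
  split_ifs
  · exact switch_term_nonneg hQ1 (Finset.sum_nonneg fun j _ => hv j) _ _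
  · exact le_rfl

/-- The possible block statistics: occupation fractions and averaged block sums. -/
def blockRange (P : Matrix S S ℝ) (d : ℕ) (F : ℝ) :
    Set ((Block P → ℝ) × (Block P → EuclideanSpace ℝ (Fin d))) :=
  {p | (∀ b, 0 ≤ p.1 b) ∧ ∑ b, p.1 b = 1 ∧ ∀ b, ‖p.2 b‖ ≤ p.1 b * F}

theorem isClosed_blockRange (F : ℝ) : IsClosed (blockRange P d F) := by
  simp only [blockRange, Set.ofPred_and, Set.ofPred_forall]
  refine IsClosed.inter (isClosed_iInter fun b => isClosed_le (by fun_prop) (by fun_prop))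
    (IsClosed.inter (isClosed_eq (by fun_prop) (by fun_prop))
      (isClosed_iInter fun b => isClosed_le (by fun_prop) (by fun_prop)))

theorem isCompact_blockRange {F : ℝ} (hF : 0 ≤ F) : IsCompact (blockRange P d F) := by
  refine IsCompact.of_isClosed_subset (IsCompact.prod
    (isCompact_univ_pi fun _ => isCompact_Icc (a := (0 : ℝ)) (b := 1))
    (isCompact_univ_pi fun _ => isCompact_closedBall (0 : EuclideanSpace ℝ (Fin d)) F))
    (isClosed_blockRange F) ?_
  rintro p ⟨h1, h2, h3⟩
  have hle : ∀ b, p.1 b ≤ 1 := fun b => by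
    rw [← h2]
    exact Finset.single_le_sum (f := p.1) (fun b _ => h1 b) (Finset.mem_univ b)
  refine ⟨fun b _ => ⟨h1 b, hle b⟩, fun b _ => ?_⟩
  rw [mem_closedBall_zero_iff]
  exact (h3 b).trans (mul_le_of_le_one_left hF (hle b))

/-- A degenerate block has Perron root `0`, so its growth rate may be as small as desired; positive
occupation then makes the score as large as desired. -/
theorem exists_tilt_of_degenerate (hP : ∀ i j, 0 ≤ P i j) (hP1 : ∀ i, ∑ j, P i j = 1) {F : ℝ}
    {p : (Block P → ℝ) × (Block P → EuclideanSpace ℝ (Fin d))} (hp : p ∈ blockRange P d F)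
    {b₀ : Block P} (hb₀ : ¬ (block P b₀.states).IsIrreducible) (hpos : 0 < p.1 b₀) (a : ℝ)
    (σ : Fin (numNondeg P) ≃ Nondeg P) :
    ∃ θ : Tilt P d, θ.Admissible Q f σ ∧ a < θ.score σ p := by
  -- The other blocks, with rate `2`, lose at most `log 2` since the fractions sum to `1`; the block
  -- `b₀` brings `a + log 2 + 1`.
  set t : ℝ := (a + Real.log 2 + 1) / p.1 b₀ with ht
  have hlog2 : 0 ≤ Real.log 2 := Real.log_nonneg one_le_two
  refine ⟨⟨0, fun b => if b = b₀ then Real.exp (-t) else 2, 0⟩, ⟨fun b => ?_, fun b => ?_, ?_⟩, ?_⟩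
  · dsimp only
    split_ifs
    · exact Real.exp_pos _
    · exact two_pos
  · dsimp only
    split_ifs with h
    · subst h
      rw [tiltedRoot_eq_zero hP f _ hb₀]
      simpa using Real.exp_pos _
    · exact tiltedRoot_zero_lt_two hP hP1 _
  · exact ⟨fun _ => le_rfl, fun _ _ => .inl rfl⟩
  · have hsw : switchScore σ (0 : Fin (numNondeg P) → ℝ) p.1 = 0 := by simp [switchScore]
    have hterm : ∀ b, p.1 b * Real.log (if b = b₀ then Real.exp (-t) else 2) ≤
        p.1 b * Real.log 2 + if b = b₀ then -(p.1 b₀ * t) else 0 := by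
      intro b
      split_ifs with h
      · subst h
        rw [Real.log_exp]
        nlinarith [mul_nonneg hpos.le hlog2]
      · simp
    have hsum := Finset.sum_le_sum fun b (_ : b ∈ Finset.univ) => hterm b
    rw [Finset.sum_add_distrib, ← Finset.sum_mul, hp.2.1, one_mul, Finset.sum_ite_eq' Finset.univ b₀,
      if_pos (Finset.mem_univ _), ht, mul_div_cancel₀ _ hpos.ne'] at hsum
    simp only [Tilt.score, hsw, Pi.zero_apply, inner_zero_left, zero_sub, Finset.sum_neg_distrib,
      sub_zero]
    linarith

/-- Below the rate function, every possible block statistic has a large score. -/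
theorem exists_tilt_of_lt_J (hP : ∀ i j, 0 ≤ P i j) (hP1 : ∀ i, ∑ j, P i j = 1)
    (hQ1 : ∀ n, 1 ≤ n → ∀ i j, Q n i j ≤ 1) {F : ℝ}
    {p : (Block P → ℝ) × (Block P → EuclideanSpace ℝ (Fin d))} (hp : p ∈ blockRange P d F)
    {a : ℝ} (ha : (a : EReal) < J P f (upperCost P Q) (∑ b, p.2 b))
    (σ : Fin (numNondeg P) ≃ Nondeg P) :
    ∃ θ : Tilt P d, θ.Admissible Q f σ ∧ a < θ.score σ p := by
  by_cases hdeg : ∃ b₀ : Block P, ¬ (block P b₀.states).IsIrreducible ∧ 0 < p.1 b₀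
  · obtain ⟨b₀, h1, h2⟩ := hdeg
    exact exists_tilt_of_degenerate hP hP1 hp h1 h2 a σ
  push Not at hdeg
  obtain ⟨hp0, hp1, hp2⟩ := hp
  have hv0 : ∀ b : Block P, ¬ (block P b.states).IsIrreducible → p.1 b = 0 := fun b hb =>
    le_antisymm (hdeg b hb) (hp0 b)
  have hy0 : ∀ b : Block P, p.1 b = 0 → p.2 b = 0 := fun b hb =>
    norm_le_zero_iff.1 (by simpa [hb] using hp2 b)
  set v : Fin (numNondeg P) → ℝ := fun i => p.1 (σ i).1 with hv
  -- At an unoccupied block the inverse is `0`; this is harmless because the block sum vanishes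
  -- there too.
  set x : Fin (numNondeg P) → EuclideanSpace ℝ (Fin d) := fun i => (v i)⁻¹ • p.2 (σ i).1 with hx
  have hvx : ∀ i, v i • x i = p.2 (σ i).1 := by
    intro i
    by_cases h : v i = 0
    · rw [h, zero_smul, hy0 _ h]
    · simp only [hx]
      rw [smul_inv_smul₀ h]
  have hcost : (a : EReal) < pathCost P f (upperCost P Q) v σ x := by
    refine ha.trans_le ?_
    refine iInf₂_le_of_le v ⟨fun i => hp0 _, ?_⟩ (iInf₂_le_of_le x ?_ (iInf_le _ σ))
    · rw [← hp1]
      exact sum_nondeg σ p.1 hv0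
    · simp_rw [hvx]
      exact sum_nondeg σ p.2 fun b hb => hy0 b (hv0 b hb)
  obtain ⟨a', haa', ha'⟩ := EReal.lt_iff_exists_real_btwn.1 hcost
  -- All switching and resting costs are put into one sum, so that the lower bound `a'` is shared
  -- among them at once.
  have hsplit : pathCost P f (upperCost P Q) v σ x = ∑ t, Sum.elim
      (fun i : Fin (numNondeg P) => if h : (i : ℕ) + 1 < numNondeg P then
        -(((∑ j ∈ Finset.Iic i, v j : ℝ) : EReal) * upperCost P Q (σ i).1 (σ ⟨i + 1, h⟩).1) else 0)
      (fun i : Fin (numNondeg P) => (v i : EReal) * restCost P f (σ i).1.states (x i)) t := by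
    rw [Fintype.sum_sum_type]
    rfl
  rw [hsplit] at ha'
  obtain ⟨u, hu1, hu2⟩ := exists_lt_le_sum_of_lt_sum _ _ (by
    rintro (i | i) -
    · simp only [Sum.elim_inl]
      split_ifs
      · exact switch_term_nonneg hQ1 (Finset.sum_nonneg fun j _ => hp0 _) _ _
      · exact le_rfl
    · exact rest_term_nonneg hP hP1 (hp0 _) _ _) ha'
  have hw : ∀ i : Fin (numNondeg P), ∃ w : ℝ, w ≤ 0 ∧
      (∀ h : (i : ℕ) + 1 < numNondeg P,
        w = 0 ∨ upperCost P Q (σ i).1 (σ ⟨i + 1, h⟩).1 < w) ∧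
      u (.inl i) ≤ -(if (i : ℕ) + 1 < numNondeg P then (∑ j ∈ Finset.Iic i, v j) * w else 0) := by
    intro i
    have h1 := hu1 (.inl i) (Finset.mem_univ _)
    simp only [Sum.elim_inl] at h1
    by_cases h : (i : ℕ) + 1 < numNondeg P
    · rw [dif_pos h] at h1
      obtain ⟨w, hw1, hw2, hw3⟩ := exists_rate_of_lt_mul
        (Finset.sum_nonneg fun j _ => hp0 _) h1
      exact ⟨w, hw1, fun _ => hw2, by rw [if_pos h]; exact hw3⟩
    · rw [dif_neg h] at h1
      refine ⟨0, le_rfl, fun _ => .inl rfl, ?_⟩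
      rw [if_neg h, neg_zero]
      exact_mod_cast h1.le
  have hl : ∀ b : Block P, ∃ (lam : EuclideanSpace ℝ (Fin d)) (r : ℝ), 0 < r ∧
      tiltedRoot P f b.states lam < ENNReal.ofReal r ∧
      ∀ i, (σ i).1 = b → u (.inr i) ≤ inner ℝ lam (p.2 b) - p.1 b * Real.log r := by
    intro b
    by_cases hb : (block P b.states).IsIrreducible
    · obtain ⟨i, hi⟩ := σ.surjective ⟨b, hb⟩
      have h1 := hu1 (.inr i) (Finset.mem_univ _)
      obtain ⟨lam, r, hr, hroot, hle⟩ := exists_tilt_of_lt_restCost hP hP1 (hp0 _) h1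
      have hib : (σ i).1 = b := by rw [hi]
      rw [hib] at hroot
      refine ⟨lam, r, hr, hroot, fun j hj => ?_⟩
      have hij : j = i := σ.injective (Subtype.ext (hj.trans hib.symm))
      subst hij
      subst hib
      rw [← hvx]
      exact hle
    · refine ⟨0, 2, two_pos, tiltedRoot_zero_lt_two hP hP1 _, fun i hi => ?_⟩
      subst hi
      exact absurd (σ i).2 hb
  choose w hw1 hw2 hw3 using hw
  choose lam r hr hroot hle using hl
  refine ⟨⟨lam, r, w⟩, ⟨hr, hroot, ⟨hw1, hw2⟩⟩, ?_⟩
  have hscore : ∑ i, u i ≤ Tilt.score ⟨lam, r, w⟩ σ p := by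
    rw [Fintype.sum_sum_type, Tilt.score, ← sum_nondeg σ _ fun b hb => ?_, add_comm, sub_eq_add_neg]
    · refine add_le_add (Finset.sum_le_sum fun i _ => hle _ i rfl) ?_
      rw [switchScore, ← Finset.sum_neg_distrib]
      exact Finset.sum_le_sum fun i _ => hw3 i
    · simp [hv0 b hb, hy0 b (hv0 b hb)]
  have : a < a' := by exact_mod_cast haa'
  linarith

end Costs

/-! ### Goodness of the rate function. -/

section RateFunction

variable {S : Type*} [Fintype S] {P : Matrix S S ℝ} {Q : ℕ → Matrix S S ℝ} {d : ℕ}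
  {f : S → EuclideanSpace ℝ (Fin d)}

theorem ereal_coe_sum {ι : Type*} (s : Finset ι) (g : ι → ℝ) :
    ((∑ i ∈ s, g i : ℝ) : EReal) = ∑ i ∈ s, (g i : EReal) :=
  map_sum (⟨⟨Real.toEReal, EReal.coe_zero⟩, EReal.coe_add⟩ : ℝ →+ EReal) g s

/-- Converse half of the duality: each term of the score is below the matching switching or resting
cost. -/
theorem score_le_pathCost (hQ1 : ∀ n, 1 ≤ n → ∀ i j, Q n i j ≤ 1)
    {σ : Fin (numNondeg P) ≃ Nondeg P} {θ : Tilt P d} (hθ : θ.Admissible Q f σ)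
    {p : (Block P → ℝ) × (Block P → EuclideanSpace ℝ (Fin d))}
    {v : Fin (numNondeg P) → ℝ} (hv : ∀ i, 0 ≤ v i)
    {x : Fin (numNondeg P) → EuclideanSpace ℝ (Fin d)}
    (hp1 : ∀ i, p.1 (σ i).1 = v i) (hp2 : ∀ i, p.2 (σ i).1 = v i • x i)
    (hp : ∀ b : Block P, ¬ (block P b.states).IsIrreducible → p.1 b = 0 ∧ p.2 b = 0) :
    (θ.score σ p : EReal) ≤ pathCost P f (upperCost P Q) v σ x := by
  rw [Tilt.score, ← sum_nondeg σ _ fun b hb => by simp [hp b hb], sub_eq_add_neg, add_comm,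
    switchScore, ← Finset.sum_neg_distrib, EReal.coe_add, ereal_coe_sum, ereal_coe_sum, pathCost]
  refine add_le_add (Finset.sum_le_sum fun i _ => ?_) (Finset.sum_le_sum fun i _ => ?_)
  · simp_rw [hp1]
    split_ifs with h
    · have hc : 0 ≤ ∑ j ∈ Finset.Iic i, v j := Finset.sum_nonneg fun j _ => hv j
      rcases hθ.above.2 i h with h0 | h0
      · rw [h0, mul_zero, neg_zero]
        exact switch_term_nonneg hQ1 hc _ _
      · rw [EReal.coe_neg, EReal.neg_le_neg_iff, EReal.coe_mul]
        exact mul_le_mul_of_nonneg_left h0.le (by exact_mod_cast hc)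
    · simp
  · rw [hp1, hp2, real_inner_smul_right, ← mul_sub, EReal.coe_mul]
    refine mul_le_mul_of_nonneg_left ?_ (by exact_mod_cast hv i)
    rw [restCost_eq]
    refine le_iSup_of_le (θ.lam (σ i).1) ?_
    rw [EReal.coe_sub]
    refine EReal.sub_le_sub le_rfl ?_
    rw [← ENNReal.log_ofReal_of_pos (hθ.rad_pos _)]
    exact ENNReal.log_monotone (hθ.root_lt _).le

/-- The block statistics whose score along `σ` is at most `a`, for all admissible parameters. -/
def scoreLevel (Q : ℕ → Matrix S S ℝ) (f : S → EuclideanSpace ℝ (Fin d)) (F : ℝ)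
    (σ : Fin (numNondeg P) ≃ Nondeg P) (a : ℝ) :
    Set ((Block P → ℝ) × (Block P → EuclideanSpace ℝ (Fin d))) :=
  blockRange P d F ∩ ⋂ (θ : Tilt P d) (_ : θ.Admissible Q f σ), {p | θ.score σ p ≤ a}

/-- The points `x i` are unrestricted, but a finite cost bounds those with positive weight by `F`.
Passing to the products `v i • x i` discards the others and lands in the compact `blockRange`. -/
theorem exists_mem_scoreLevel (hP : ∀ i j, 0 ≤ P i j) (hP1 : ∀ i, ∑ j, P i j = 1)
    (hQ1 : ∀ n, 1 ≤ n → ∀ i j, Q n i j ≤ 1) {F : ℝ} (hF : ∀ s, ‖f s‖ ≤ F)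
    {z : EuclideanSpace ℝ (Fin d)} {a : ℝ} (hz : J P f (upperCost P Q) z < a) :
    ∃ σ : Fin (numNondeg P) ≃ Nondeg P, ∃ p ∈ scoreLevel Q f F σ a, ∑ b, p.2 b = z := by
  classical
  simp only [J, iInf_lt_iff] at hz
  obtain ⟨v, ⟨hv0, hv1⟩, x, hx, σ, hcost⟩ := hz
  have hrest : ∀ i, (v i : EReal) * restCost P f (σ i).1.states (x i) ≠ ⊤ := by
    intro i htop
    have h1 : (v i : EReal) * restCost P f (σ i).1.states (x i) ≤
        pathCost P f (upperCost P Q) v σ x := by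
      refine le_trans (Finset.single_le_sum
        (f := fun i => (v i : EReal) * restCost P f (σ i).1.states (x i))
        (fun i _ => rest_term_nonneg hP hP1 (hv0 i) _ _) (Finset.mem_univ i)) ?_
      refine le_add_of_nonneg_left (Finset.sum_nonneg fun i _ => ?_)
      split_ifs
      · exact switch_term_nonneg hQ1 (Finset.sum_nonneg fun j _ => hv0 j) _ _
      · exact le_rfl
    rw [htop] at h1
    exact absurd (h1.trans_lt hcost) (not_lt.2 le_top)
  have hnorm : ∀ i, ‖v i • x i‖ ≤ v i * F := by
    intro i
    rcases (hv0 i).eq_or_lt with h0 | h0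
    · simp [← h0]
    · rw [norm_smul, Real.norm_of_nonneg h0.le]
      refine mul_le_mul_of_nonneg_left ?_ h0.le
      refine norm_le_of_restCost_ne_top hP hP1 (C := (σ i).1.states) hF fun htop => hrest i ?_
      rw [htop, EReal.coe_mul_top_of_pos h0]
  set p : (Block P → ℝ) × (Block P → EuclideanSpace ℝ (Fin d)) :=
    (fun b => if h : (block P b.states).IsIrreducible then v (σ.symm ⟨b, h⟩) else 0,
      fun b => if h : (block P b.states).IsIrreducible then
        v (σ.symm ⟨b, h⟩) • x (σ.symm ⟨b, h⟩) else 0) with hpdef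
  have hsymm : ∀ i (h : (block P (σ i).1.states).IsIrreducible), σ.symm ⟨(σ i).1, h⟩ = i :=
    fun i h => σ.symm_apply_apply i
  have hp1 : ∀ i, p.1 (σ i).1 = v i := fun i => by
    have h : (block P (σ i).1.states).IsIrreducible := (σ i).2
    simp only [hpdef, dif_pos h, hsymm]
  have hp2 : ∀ i, p.2 (σ i).1 = v i • x i := fun i => by
    have h : (block P (σ i).1.states).IsIrreducible := (σ i).2
    simp only [hpdef, dif_pos h, hsymm]
  have hp0 : ∀ b : Block P, ¬ (block P b.states).IsIrreducible → p.1 b = 0 ∧ p.2 b = 0 :=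
    fun b hb => by simp only [hpdef, dif_neg hb, and_self]
  refine ⟨σ, p, ⟨⟨fun b => ?_, ?_, fun b => ?_⟩, ?_⟩, ?_⟩
  · simp only [hpdef]
    split_ifs
    exacts [hv0 _, le_rfl]
  · rw [← sum_nondeg σ p.1 fun b hb => (hp0 b hb).1, ← hv1]
    exact Finset.sum_congr rfl fun i _ => hp1 i
  · simp only [hpdef]
    split_ifs
    exacts [hnorm _, by simp]
  · simp only [Set.mem_iInter]
    intro θ hθ
    have h1 := (score_le_pathCost hQ1 hθ hv0 hp1 hp2 hp0).trans hcost.le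
    exact EReal.coe_le_coe_iff.1 h1
  · rw [← sum_nondeg σ p.2 fun b hb => (hp0 b hb).2, ← hx]
    exact Finset.sum_congr rfl fun i _ => hp2 i

theorem isCompact_scoreLevel {F : ℝ} (hF : 0 ≤ F) (σ : Fin (numNondeg P) ≃ Nondeg P) (a : ℝ) :
    IsCompact (scoreLevel Q f F σ a) :=
  (isCompact_blockRange hF).inter_right (isClosed_iInter fun θ => isClosed_iInter fun _ =>
    isClosed_le (θ.continuous_score σ) continuous_const)

/-- The compact sets `D a` are squeezed: `{J < a} ⊆ D a ⊆ {J ≤ a}`. Hence `{J ≤ a}` is the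
intersection of the `D ε` with `ε > a`. -/
theorem isGoodRateFunction_J (hP : ∀ i j, 0 ≤ P i j) (hP1 : ∀ i, ∑ j, P i j = 1)
    (hQ1 : ∀ n, 1 ≤ n → ∀ i j, Q n i j ≤ 1) {F : ℝ} (hF0 : 0 ≤ F) (hF : ∀ s, ‖f s‖ ≤ F) :
    IsGoodRateFunction (J P f (upperCost P Q)) := by
  have hnonneg : ∀ z, 0 ≤ J P f (upperCost P Q) z := fun z => by
    refine le_iInf₂ fun v hv => le_iInf₂ fun x _ => le_iInf fun σ => ?_
    exact pathCost_nonneg hP hP1 hQ1 hv.1 σ x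
  set D : ℝ → Set (EuclideanSpace ℝ (Fin d)) := fun a =>
    ⋃ σ : Fin (numNondeg P) ≃ Nondeg P,
      (fun p : (Block P → ℝ) × (Block P → EuclideanSpace ℝ (Fin d)) => ∑ b, p.2 b) ''
        scoreLevel Q f F σ a with hD
  have hDc : ∀ a, IsCompact (D a) := fun a => isCompact_iUnion fun σ =>
    (isCompact_scoreLevel hF0 σ a).image (by fun_prop)
  have hDJ : ∀ a z, z ∈ D a → J P f (upperCost P Q) z ≤ a := by
    intro a z hz
    obtain ⟨σ, p, hp, rfl⟩ := Set.mem_iUnion.1 hz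
    by_contra! hlt
    obtain ⟨θ, hθ, hlt'⟩ := exists_tilt_of_lt_J hP hP1 hQ1 hp.1 hlt σ
    have := Set.mem_iInter₂.1 hp.2 θ hθ
    exact absurd hlt' (not_lt.2 this)
  have hJD : ∀ (a : ℝ) z, J P f (upperCost P Q) z < a → z ∈ D a := by
    intro a z hz
    obtain ⟨σ, p, hp, hpz⟩ := exists_mem_scoreLevel hP hP1 hQ1 hF hz
    exact Set.mem_iUnion.2 ⟨σ, p, hp, hpz⟩
  have hlevel : ∀ a : ℝ, {z | J P f (upperCost P Q) z ≤ (a : EReal)} = ⋂ ε : Set.Ioi a, D ε := by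
    intro a
    ext z
    simp only [Set.mem_iInter]
    constructor
    · intro hz ε
      exact hJD ε z (lt_of_le_of_lt hz (by exact_mod_cast ε.2))
    · intro hz
      refine EReal.le_of_forall_lt_iff_le.1 fun b hb => ?_
      exact hDJ b z (hz ⟨b, by exact_mod_cast hb⟩)
  have hcompact : ∀ a : ℝ, IsCompact {z | J P f (upperCost P Q) z ≤ (a : EReal)} := by
    intro a
    rw [hlevel a]
    refine (hDc (a + 1)).of_isClosed_subset (isClosed_iInter fun ε => (hDc ε).isClosed) ?_
    exact Set.iInter_subset_of_subset ⟨a + 1, by simp⟩ subset_rfl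
  refine ⟨hnonneg, lowerSemicontinuous_iff_isClosed_preimage.2 fun y => ?_, hcompact⟩
  induction y with
  | bot =>
    convert isClosed_empty
    ext z
    simp only [Set.mem_preimage, Set.mem_Iic, le_bot_iff, Set.mem_empty_iff_false, iff_false]
    intro h
    have := hnonneg z
    simp [h] at this
  | coe a => exact (hcompact a).isClosed
  | top => simp

end RateFunction

/-! ### The upper bound for closed sets. -/

section UpperBound

variable {S : Type*} [Fintype S] {P : Matrix S S ℝ} {Q : ℕ → Matrix S S ℝ} {d : ℕ}
  {f : S → EuclideanSpace ℝ (Fin d)}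

theorem blockTotals_mem_blockRange {F : ℝ} (hF : ∀ s, ‖f s‖ ≤ F) {n : ℕ} (hn : 1 ≤ n)
    (x : ℕ → S) : (1 / (n : ℝ)) • blockTotals P f n x ∈ blockRange P d F := by
  have hn' : (0 : ℝ) < n := by exact_mod_cast hn
  refine ⟨fun b => ?_, ?_, fun b => ?_⟩
  · simp only [Prod.smul_fst, Pi.smul_apply, smul_eq_mul, blockTotals]
    positivity
  · simp only [Prod.smul_fst, Pi.smul_apply, smul_eq_mul, blockTotals]
    rw [← Finset.mul_sum, ← Nat.cast_sum, sum_visits, one_div, inv_mul_cancel₀ hn'.ne']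
  · simp only [Prod.smul_fst, Prod.smul_snd, Pi.smul_apply, smul_eq_mul, blockTotals]
    rw [norm_smul, Real.norm_of_nonneg (by positivity), mul_assoc]
    refine mul_le_mul_of_nonneg_left ?_ (by positivity)
    refine (norm_sum_le _ _).trans ((Finset.sum_le_sum fun k _ => hF (x k)).trans ?_)
    rw [Finset.sum_const, nsmul_eq_mul, visits]

theorem sum_blockTotals (n : ℕ) (x : ℕ → S) :
    ∑ b, ((1 / (n : ℝ)) • blockTotals P f n x).2 b = Z f n x := by
  simp only [Prod.smul_snd, Pi.smul_apply, blockTotals, Z]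
  rw [← Finset.smul_sum, Finset.sum_fiberwise]

theorem exists_order (x : ℕ → Block P) (n : ℕ) :
    ∃ σ : Fin (numNondeg P) ≃ Nondeg P, Monotone fun i => lastVisit x n (σ i).1 := by
  set e : Fin (numNondeg P) ≃ Nondeg P := (Finite.equivFin (Nondeg P)).symm
  exact ⟨(Tuple.sort fun i => lastVisit x n (e i).1).trans e,
    Tuple.monotone_sort fun i => lastVisit x n (e i).1⟩

open Classical in
/-- The weight of the paths whose average lies in a closed set on which the rate function exceeds
`a`. -/
theorem exists_sum_paths_closed_le (hP : ∀ i j, 0 ≤ P i j) (hP1 : ∀ i, ∑ j, P i j = 1)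
    (hQ0 : ∀ n, 1 ≤ n → ∀ i j, 0 ≤ Q n i j) (hQ1 : ∀ n, 1 ≤ n → ∀ i j, Q n i j ≤ 1)
    (hlim : ∀ i j, Tendsto (fun n => Q n i j) atTop (𝓝 (P i j)))
    {G : Set (EuclideanSpace ℝ (Fin d))} (hG : IsClosed G) {a : ℝ}
    (ha : ∀ z ∈ G, (a : EReal) < J P f (upperCost P Q) z) :
    ∃ (C : ℝ) (m : ℕ), 0 ≤ C ∧ ∀ n : ℕ, 1 ≤ n →
      ∑ x : Fin (n + 1) → S with Z f n (extPath x) ∈ G,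
        ∏ k ∈ Finset.range n, Q (k + 1) (extPath x k) (extPath x (k + 1)) ≤
      C * ((n : ℝ) + 1) ^ m * Real.exp (-(n * a)) := by
  set F : ℝ := ∑ s, ‖f s‖
  have hF : ∀ s, ‖f s‖ ≤ F := fun s => Finset.single_le_sum (f := fun s => ‖f s‖)
    (fun _ _ => norm_nonneg _) (Finset.mem_univ s)
  have hF0 : 0 ≤ F := Finset.sum_nonneg fun _ _ => norm_nonneg _
  set K : Set ((Block P → ℝ) × (Block P → EuclideanSpace ℝ (Fin d))) :=
    blockRange P d F ∩ {p | ∑ b, p.2 b ∈ G} with hK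
  have hKc : IsCompact K := (isCompact_blockRange hF0).inter_right
    (hG.preimage (f := fun p : (Block P → ℝ) × (Block P → EuclideanSpace ℝ (Fin d)) =>
      ∑ b, p.2 b) (by fun_prop))
  -- Scores are continuous in the statistic, so the sets where one exceeds `a` form an open cover of
  -- the compact `K`; each order needs only finitely many parameters.
  have hcov : ∀ σ : Fin (numNondeg P) ≃ Nondeg P,
      ∃ t : Finset {θ : Tilt P d // θ.Admissible Q f σ}, K ⊆ ⋃ θ ∈ t, {p | a < θ.1.score σ p} := by
    intro σ
    refine hKc.elim_finite_subcover _ (fun θ => isOpen_lt continuous_const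
      (θ.1.continuous_score σ)) fun p hp => ?_
    obtain ⟨θ, hθ, h⟩ := exists_tilt_of_lt_J hP hP1 hQ1 hp.1 (ha _ hp.2) σ
    exact Set.mem_iUnion.2 ⟨⟨θ, hθ⟩, h⟩
  choose t ht using hcov
  choose C m hC hsum using fun (σ : Fin (numNondeg P) ≃ Nondeg P)
    (θ : {θ : Tilt P d // θ.Admissible Q f σ}) =>
    exists_sum_paths_score_le hP hQ0 hQ1 hlim f σ θ.2 a
  have : Fintype (Fin (numNondeg P) ≃ Nondeg P) := Fintype.ofFinite _
  set m' : ℕ := ∑ σ, ∑ θ ∈ t σ, m σ θ with hm'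
  have hm : ∀ σ, ∀ θ ∈ t σ, m σ θ ≤ m' := fun σ θ hθ =>
    (Finset.single_le_sum (f := fun θ => m σ θ) (fun _ _ => Nat.zero_le _) hθ).trans
      (Finset.single_le_sum (f := fun σ => ∑ θ ∈ t σ, m σ θ) (fun _ _ => Nat.zero_le _)
        (Finset.mem_univ σ))
  refine ⟨∑ σ, ∑ θ ∈ t σ, C σ θ, m', Finset.sum_nonneg fun σ _ => Finset.sum_nonneg fun θ _ =>
    hC σ θ, fun n hn => ?_⟩
  set q : (Fin (n + 1) → S) → ℝ := fun x =>
    ∏ k ∈ Finset.range n, Q (k + 1) (extPath x k) (extPath x (k + 1)) with hq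
  have hq0 : ∀ x, 0 ≤ q x := fun x => Finset.prod_nonneg fun k _ => hQ0 _ (by omega) _ _
  set R : (σ : Fin (numNondeg P) ≃ Nondeg P) → {θ : Tilt P d // θ.Admissible Q f σ} →
      (Fin (n + 1) → S) → Prop := fun σ θ x =>
    Monotone (fun i => lastVisit (fun k => blockOf P (extPath x k)) n (σ i).1) ∧
      a ≤ θ.1.score σ ((1 / (n : ℝ)) • blockTotals P f n (extPath x)) with hR
  -- Each path is charged to its own order of last visits and to some parameter whose open set
  -- contains its statistic.
  have hpath : ∀ x : Fin (n + 1) → S, Z f n (extPath x) ∈ G →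
      q x ≤ ∑ σ, ∑ θ ∈ t σ, if R σ θ x then q x else 0 := by
    intro x hx
    obtain ⟨σ, hσ⟩ := exists_order (fun k => blockOf P (extPath x k)) n
    have hmem : (1 / (n : ℝ)) • blockTotals P f n (extPath x) ∈ K :=
      ⟨blockTotals_mem_blockRange hF hn _, by
        rw [Set.mem_ofPred_eq, sum_blockTotals]
        exact hx⟩
    obtain ⟨θ, hθ, hlt⟩ := Set.mem_iUnion₂.1 (ht σ hmem)
    have hnn : ∀ σ θ, 0 ≤ if R σ θ x then q x else 0 := fun σ θ => by
      split_ifs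
      exacts [hq0 x, le_rfl]
    calc q x = if R σ θ x then q x else 0 := (if_pos ⟨hσ, le_of_lt hlt⟩).symm
      _ ≤ ∑ θ ∈ t σ, if R σ θ x then q x else 0 :=
          Finset.single_le_sum (f := fun θ => if R σ θ x then q x else 0) (fun θ _ => hnn σ θ) hθ
      _ ≤ _ := Finset.single_le_sum (f := fun σ => ∑ θ ∈ t σ, if R σ θ x then q x else 0)
          (fun σ _ => Finset.sum_nonneg fun θ _ => hnn σ θ) (Finset.mem_univ σ)
  calc ∑ x : Fin (n + 1) → S with Z f n (extPath x) ∈ G, q x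
      ≤ ∑ x : Fin (n + 1) → S with Z f n (extPath x) ∈ G,
          ∑ σ, ∑ θ ∈ t σ, if R σ θ x then q x else 0 :=
        Finset.sum_le_sum fun x hx => hpath x (Finset.mem_filter.1 hx).2
    _ ≤ ∑ x : Fin (n + 1) → S, ∑ σ, ∑ θ ∈ t σ, if R σ θ x then q x else 0 :=
        Finset.sum_le_univ_sum_of_nonneg fun x => Finset.sum_nonneg fun σ _ =>
          Finset.sum_nonneg fun θ _ => by split_ifs; exacts [hq0 x, le_rfl]
    _ = ∑ σ, ∑ θ ∈ t σ, ∑ x : Fin (n + 1) → S with R σ θ x, q x := by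
        rw [Finset.sum_comm]
        refine Finset.sum_congr rfl fun σ _ => ?_
        rw [Finset.sum_comm]
        exact Finset.sum_congr rfl fun θ _ => (Finset.sum_filter _ _).symm
    _ ≤ ∑ σ, ∑ θ ∈ t σ, C σ θ * (((n : ℝ) + 1) ^ m' * Real.exp (-(n * a))) := by
        refine Finset.sum_le_sum fun σ _ => Finset.sum_le_sum fun θ hθ => ?_
        refine (hsum σ θ n hn).trans ?_
        rw [mul_assoc]
        refine mul_le_mul_of_nonneg_left (mul_le_mul_of_nonneg_right ?_ (Real.exp_pos _).le)
          (hC σ θ)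
        exact pow_le_pow_right₀ (by simp) (hm σ θ hθ)
    _ = _ := by
        simp_rw [← Finset.sum_mul]
        rw [mul_assoc]

theorem eventually_poly_mul_exp_le (C : ℝ) (m : ℕ) {a c : ℝ} (hca : c < a) :
    ∀ᶠ n : ℕ in atTop, C * ((n : ℝ) + 1) ^ m * Real.exp (-(n * a)) ≤ Real.exp (-(n * c)) := by
  have h1 : Tendsto (fun t : ℝ => t ^ m * Real.exp (-(a - c) * t)) atTop (𝓝 0) := by
    simpa using tendsto_rpow_mul_exp_neg_mul_atTop_nhds_zero m (a - c) (by linarith)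
  have h2 : Tendsto (fun n : ℕ => C * Real.exp (a - c) *
      (((n : ℝ) + 1) ^ m * Real.exp (-(a - c) * ((n : ℝ) + 1)))) atTop (𝓝 0) := by
    have h3 := (h1.comp (tendsto_atTop_add_const_right _ 1 tendsto_natCast_atTop_atTop)).const_mul
      (C * Real.exp (a - c))
    rwa [mul_zero] at h3
  filter_upwards [h2.eventually (gt_mem_nhds one_pos)] with n hn
  have h4 : C * ((n : ℝ) + 1) ^ m * Real.exp (-(n * a)) = (C * Real.exp (a - c) *
      (((n : ℝ) + 1) ^ m * Real.exp (-(a - c) * ((n : ℝ) + 1)))) * Real.exp (-(n * c)) := by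
    have h5 : Real.exp (-(n * a)) = Real.exp (a - c) * Real.exp (-(a - c) * ((n : ℝ) + 1)) *
        Real.exp (-(n * c)) := by
      rw [← Real.exp_add, ← Real.exp_add]
      congr 1
      ring
    rw [h5]
    ring
  rw [h4]
  exact mul_le_of_le_one_left (Real.exp_pos _).le hn.le

/-- The large deviation upper bound for closed sets. -/
theorem limsup_log_markovMeasure_le [DecidableEq S] [MeasurableSpace S]
    [MeasurableSingletonClass S] (hP : P ∈ Matrix.rowStochastic ℝ S)
    (hQ : ∀ n, 1 ≤ n → Q n ∈ Matrix.rowStochastic ℝ S)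
    (hlim : ∀ i j, Tendsto (fun n => Q n i j) atTop (𝓝 (P i j))) (π : PMF S)
    {G : Set (EuclideanSpace ℝ (Fin d))} (hG : IsClosed G) :
    limsup (fun n : ℕ => ((1 / (n : ℝ) : ℝ) : EReal) *
        ENNReal.log (markovMeasure π Q hQ {ω | Z f n ω ∈ G})) atTop ≤
      -(⨅ z ∈ G, J P f (upperCost P Q) z) := by
  classical
  have hQ0 : ∀ n, 1 ≤ n → ∀ i j, 0 ≤ Q n i j := fun n hn => (hQ n hn).1
  have hQ1 : ∀ n, 1 ≤ n → ∀ i j, Q n i j ≤ 1 := fun n hn i j => by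
    rw [← Matrix.sum_row_of_mem_rowStochastic (hQ n hn) i]
    exact Finset.single_le_sum (f := fun j => Q n i j) (fun j _ => hQ0 n hn i j)
      (Finset.mem_univ j)
  rw [EReal.le_neg]
  refine le_of_forall_lt fun b hb => ?_
  obtain ⟨c, hbc, hc⟩ := EReal.lt_iff_exists_real_btwn.1 hb
  -- The gap between `c` and `a` absorbs the polynomial prefactor.
  obtain ⟨a, hca, ha⟩ := EReal.lt_iff_exists_real_btwn.1 hc
  refine hbc.trans_le (EReal.le_neg.2 ?_)
  obtain ⟨C, m, -, hsum⟩ := exists_sum_paths_closed_le hP.1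
    (Matrix.sum_row_of_mem_rowStochastic hP) hQ0 hQ1 hlim (f := f) hG (a := a)
    fun z hz => ha.trans_le (iInf₂_le z hz)
  refine limsup_le_of_le (by isBoundedDefault) ?_
  filter_upwards [eventually_poly_mul_exp_le C m (by exact_mod_cast hca : c < a),
    eventually_ge_atTop 1] with n hn hn1
  have hn' : (0 : ℝ) < n := by exact_mod_cast hn1
  have hmeas : markovMeasure π Q hQ {ω | Z f n ω ∈ G} ≤ ENNReal.ofReal (Real.exp (-(n * c))) := by
    refine (markovMeasure_le_sum_paths π Q hQ n _ fun ω ω' h hω => ?_).trans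
      (ENNReal.ofReal_le_ofReal ((hsum n hn1).trans hn))
    have hZ : Z f n ω' = Z f n ω := by
      unfold Z
      congr 1
      exact Finset.sum_congr rfl fun i hi => by rw [h i (Finset.mem_Icc.1 hi).2]
    rw [Set.mem_ofPred_eq, hZ]
    exact hω
  have hlog := ENNReal.log_monotone hmeas
  rw [ENNReal.log_ofReal_of_pos (Real.exp_pos _), Real.log_exp] at hlog
  refine (mul_le_mul_of_nonneg_left hlog (show (0 : EReal) ≤ ((1 / (n : ℝ) : ℝ) : EReal) by
    exact_mod_cast (by positivity))).trans (le_of_eq ?_)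
  rw [← EReal.coe_mul, ← EReal.coe_neg]
  congr 1
  field_simp

end UpperBound

end PerturbedChain

theorem theorem3p1 {S : Type*} [Fintype S] [DecidableEq S] [MeasurableSpace S]
    [MeasurableSingletonClass S] {d : ℕ}
    (P : Matrix S S ℝ) (hP : P ∈ Matrix.rowStochastic ℝ S)
    (Q : ℕ → Matrix S S ℝ) (hQ : ∀ n, 1 ≤ n → Q n ∈ Matrix.rowStochastic ℝ S)
    (hlim : ∀ i j, Tendsto (fun n => Q n i j) atTop (𝓝 (P i j)))
    (π : PMF S) (f : S → EuclideanSpace ℝ (Fin d)) :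
    PerturbedChain.IsGoodRateFunction
        (PerturbedChain.J P f (PerturbedChain.upperCost P Q)) ∧
      ∀ Γ : Set (EuclideanSpace ℝ (Fin d)), MeasurableSet Γ →
        limsup (fun n : ℕ => ((1 / (n : ℝ) : ℝ) : EReal) *
            ENNReal.log (PerturbedChain.markovMeasure π Q hQ
              {ω | PerturbedChain.Z f n ω ∈ closure Γ})) atTop
          ≤ -(⨅ z ∈ closure Γ, PerturbedChain.J P f (PerturbedChain.upperCost P Q) z) := by
  refine ⟨PerturbedChain.isGoodRateFunction_J hP.1 (Matrix.sum_row_of_mem_rowStochastic hP)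
    (fun n hn i j => ?_) (F := ∑ s, ‖f s‖) (Finset.sum_nonneg fun _ _ => norm_nonneg _)
    fun s => Finset.single_le_sum (f := fun s => ‖f s‖) (fun _ _ => norm_nonneg _)
      (Finset.mem_univ s),
    fun Γ _ => PerturbedChain.limsup_log_markovMeasure_le hP hQ hlim π isClosed_closure⟩
  rw [← Matrix.sum_row_of_mem_rowStochastic (hQ n hn) i]
  exact Finset.single_le_sum (f := fun j => Q n i j) (fun j _ => (hQ n hn).1 i j)
    (Finset.mem_univ j)
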